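/- **Setting.** Let $\mathfrak{g}$ be a finite-dimensional complex simple Lie algebra with a Cartan subalgebra $\mathfrak{h}$ and simple roots $\alpha_1,\dots,\alpha_r$. Let $(\cdot,\cdot)$ be the bilinear form on $\mathfrak{h}^*$ induced by the Killing form, rescaled so that the short roots satisfy $(\alpha,\alpha)=2$. Put $d_i=(\alpha_i,\alpha_i)/2$, $a_{ij}=2(\alpha_i,\alpha_j)/(\alpha_i,\alpha_i)$, and let $\rho$ be the half-sum of the positive roots. Let $q>0$ be real, $q\neq 1$, put $q_i=q^{d_i}$ and $[x]_p=\dfrac{p^x-p^{-x}}{p-p^{-1}}$. The algebra $U_q(\mathfrak{g})$ is generated by $E_i,F_i,K_i,K_i^{-1}$ $(1\le i\le r)$ with relations $K_iK_i^{-1}=K_i^{-1}K_i=1$, $K_iK_j=K_jK_i$, $K_iE_jK_i^{-1}=q_i^{a_{ij}}E_j$, $K_iF_jK_i^{-1}=q_i^{-a_{ij}}F_j$, $E_iF_j-F_jE_i=\delta_{ij}\dfrac{K_i-K_i^{-1}}{q_i-q_i^{-1}}$ and, for $i\neq j$, the quantum Serre relations $$\sum_{k=0}^{1-a_{ij}}(-1)^k\binom{1-a_{ij}}{k}_{q_i}E_i^{1-a_{ij}-k}E_jE_i^k=0,\qquad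 \sum_{k=0}^{1-a_{ij}}(-1)^k\binom{1-a_{ij}}{k}_{q_i}F_i^{1-a_{ij}-k}F_jF_i^k=0,$$ where $\binom{m}{k}_p=\frac{[m]_p!}{[k]_p!\,[m-k]_p!}$ and $[m]_p!=[1]_p\cdots[m]_p$. It is a Hopf $*$-algebra with $$\Delta(K_i)=K_i\otimes K_i,\quad \Delta(E_i)=E_i\otimes K_i+1\otimes E_i,\quad \Delta(F_i)=F_i\otimes 1+K_i^{-1}\otimes F_i,$$ $$S(K_i)=K_i^{-1},\quad S(E_i)=-E_iK_i^{-1},\quad S(F_i)=-K_iF_i,\quad \varepsilon(K_i)=1,\quad \varepsilon(E_i)=\varepsilon(F_i)=0,$$ $$K_i^*=K_i,\quad E_i^*=K_iF_i,\quad F_i^*=E_iK_i^{-1}.$$ For $\lambda=\sum_i n_i\alpha_i$ with $n_i\in\mathbb{Z}$ put $K_\lambda=\prod_i K_i^{n_i}$. Let $\mathbb{C}_q[G]\subset U_q(\mathfrak{g})^*$ be the algebra spanned by the matrix coefficients of the finite-dimensional (type one) representations, with product $(\phi\psi)(X)=(\phi\otimes\psi)(\Delta(X))$, $\phi^*(X)=\overline{\phi(S(X)^*)}$,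 left action $(X\triangleright\phi)(Y)=\phi(YX)$ and counit $\varepsilon(\phi)=\phi(1)$. Let $V(\Lambda)$ be an irreducible finite-dimensional representation of $U_q(\mathfrak{g})$ of dominant integral highest weight $\Lambda$, with an inner product for which $(Xv,w)=(v,X^*w)$. Fix an orthonormal basis $v_1,\dots,v_N$ of weight vectors, $K_jv_i=q^{(\alpha_j,\lambda_i)}v_i$ with $\lambda_i$ integral weights. Let $\pi(X)^i_j$ be the matrix of $X$ in this basis, $Xv_j=\sum_i\pi(X)^i_jv_i$, and let $u^i_j\in\mathbb{C}_q[G]$ be $u^i_j(X)=\pi(X)^i_j$. Define the $N\times N$ matrices $\mathsf{M}^n_m$ over $\mathbb{C}_q[G]$ by $(\mathsf{M}^n_m)^i_j=(u^m_i)^*u^n_j$. For a matrix $\mathsf{P}$ over $\mathbb{C}_q[G]$ put $$C(\mathsf{P})=\mathrm{Tr}\bigl(\pi(K_{2\rho}^{-1})(2\mathsf{P}-\mathrm{Id})\otimes\mathsf{P}\otimes\mathsf{P}\bigr)=\sum_{i,j,k,l}\pi(K_{2\rho}^{-1})^i_j\,(2\mathsf{P}-\mathrm{Id})^j_k\otimes\mathsf{P}^k_l\otimes\mathsf{P}^l_i\in\mathbb{C}_q[G]^{\otimes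 3},$$ and for $1\le a\le r$ let $\eta_a:\mathbb{C}_q[G]^{\otimes 3}\to\mathbb{C}$ be the linear functional $$\eta_a(x_0\otimes x_1\otimes x_2)=\varepsilon(x_0)\,\varepsilon(F_a\triangleright x_1)\,\varepsilon(E_a\triangleright x_2).$$ **Theorem.** Let $c^m_n\in\mathbb{C}$ $(1\le m,n\le N)$ be such that $c^m_n=0$ whenever $\lambda_m\neq\lambda_n$, and suppose that $\mathsf{P}=\sum_{m,n}c^m_n\mathsf{M}^n_m$ is a projection, that is, $\mathsf{P}^2=\mathsf{P}$. Then for every $a\in\{1,\dots,r\}$ $$\eta_a(C(\mathsf{P}))=\sum_{i=1}^N c^i_i\,q^{(\alpha_a-2\rho,\lambda_i)}\,[d_a^{-1}(\alpha_a,\lambda_i)]_{q_a}.$$ -/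

import Mathlib

open scoped TensorProduct

noncomputable section

namespace QuantumFlag

/-! ### Quantum integers and the quantum Serre expression -/

/-- The `p`-number `[x]_p = (p ^ x - p ^ (-x)) / (p - p⁻¹)`. -/
def qNumber (p x : ℂ) : ℂ := (p ^ x - p ^ (-x)) / (p - p⁻¹)

/-- `[n]_p! = [1]_p [2]_p ⋯ [n]_p`. -/
def qFactorial (p : ℂ) (n : ℕ) : ℂ := ∏ k ∈ Finset.range n, qNumber p ((k + 1 : ℕ) : ℂ)

/-- The symmetric `p`-binomial coefficient `[n]_p! / ([k]_p! [n - k]_p!)` for `k ≤ n`. -/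
def qBinomial (p : ℂ) (n k : ℕ) : ℂ :=
  qFactorial p n / (qFactorial p k * qFactorial p (n - k))

/-- `∑ₖ (-1)ᵏ [m choose k]_p x ^ (m - k) z x ^ k`. -/
def serreSum {B : Type*} [Ring B] [Algebra ℂ B] (p : ℂ) (m : ℕ) (x z : B) : B :=
  ∑ k ∈ Finset.range (m + 1), ((-1) ^ k * qBinomial p m k) • (x ^ (m - k) * z * x ^ k)

lemma qNumber_nat {p : ℂ} (n : ℕ) :
    qNumber p (n : ℂ) = (p ^ n - (p ^ n)⁻¹) / (p - p⁻¹) := by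
  simp [qNumber, Complex.cpow_neg]

section generic

variable {p : ℂ}

lemma sub_inv_ne_zero (h0 : p ≠ 0)
    (h1 : ∀ n : ℕ, 0 < n → p ^ n ≠ 1) : p - p⁻¹ ≠ 0 := by
  intro h
  apply h1 2 (by norm_num)
  rw [sub_eq_zero] at h
  field_simp at h
  exact h

lemma qNumber_nat_ne_zero (h0 : p ≠ 0)
    (h1 : ∀ n : ℕ, 0 < n → p ^ n ≠ 1) {n : ℕ} (hn : 0 < n) : qNumber p (n : ℂ) ≠ 0 := by
  rw [qNumber_nat]
  refine div_ne_zero ?_ (sub_inv_ne_zero h0 h1)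
  intro h
  apply h1 (2 * n) (by omega)
  rw [sub_eq_zero] at h
  have : p ^ n ≠ 0 := pow_ne_zero _ h0
  field_simp at h
  rw [mul_comm, pow_mul]; exact h

lemma qFactorial_zero (p : ℂ) : qFactorial p 0 = 1 := by simp [qFactorial]

lemma qFactorial_succ (p : ℂ) (n : ℕ) :
    qFactorial p (n + 1) = qFactorial p n * qNumber p ((n + 1 : ℕ) : ℂ) := by
  simp [qFactorial, Finset.prod_range_succ]

lemma qFactorial_ne_zero (h0 : p ≠ 0)
    (h1 : ∀ n : ℕ, 0 < n → p ^ n ≠ 1) (n : ℕ) : qFactorial p n ≠ 0 :=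
  Finset.prod_ne_zero_iff.2 fun _ _ => qNumber_nat_ne_zero h0 h1 (by omega)

lemma qBinomial_zero (h0 : p ≠ 0)
    (h1 : ∀ n : ℕ, 0 < n → p ^ n ≠ 1) (n : ℕ) : qBinomial p n 0 = 1 := by
  simp [qBinomial, qFactorial_zero, qFactorial_ne_zero h0 h1]

lemma qBinomial_self (h0 : p ≠ 0)
    (h1 : ∀ n : ℕ, 0 < n → p ^ n ≠ 1) (n : ℕ) : qBinomial p n n = 1 := by
  simp [qBinomial, qFactorial_zero, qFactorial_ne_zero h0 h1]

lemma qBinomial_symm {n k : ℕ} (hk : k ≤ n) : qBinomial p n (n - k) = qBinomial p n k := by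
  rw [qBinomial, qBinomial, Nat.sub_sub_self hk, mul_comm]

lemma qNumber_add (h0 : p ≠ 0)
    (h1 : ∀ n : ℕ, 0 < n → p ^ n ≠ 1) (a b : ℕ) :
    qNumber p ((a + b : ℕ) : ℂ) =
      p ^ (a : ℤ) * qNumber p (b : ℂ) + p ^ (-(b : ℤ)) * qNumber p (a : ℂ) := by
  have := sub_inv_ne_zero h0 h1
  rw [qNumber_nat, qNumber_nat, qNumber_nat, zpow_neg, zpow_natCast, zpow_natCast, ← mul_div_assoc,
    ← mul_div_assoc, ← add_div]
  congr 1
  rw [pow_add]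
  have ha : p ^ a ≠ 0 := pow_ne_zero _ h0
  have hb : p ^ b ≠ 0 := pow_ne_zero _ h0
  field_simp
  ring

lemma qBinomial_pascal (h0 : p ≠ 0)
    (h1 : ∀ n : ℕ, 0 < n → p ^ n ≠ 1) {n k : ℕ} (hk : k < n) :
    qBinomial p (n + 1) (k + 1) =
      p ^ ((k : ℤ) + 1) * qBinomial p n (k + 1) + p ^ ((k : ℤ) - n) * qBinomial p n k := by
  obtain ⟨m, rfl⟩ : ∃ m, n = k + 1 + m := ⟨n - (k + 1), by omega⟩
  have e1 : k + 1 + m + 1 - (k + 1) = m + 1 := by omega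
  have e2 : k + 1 + m - (k + 1) = m := by omega
  have e3 : k + 1 + m - k = m + 1 := by omega
  simp only [qBinomial, e1, e2, e3, qFactorial_succ p m, qFactorial_succ p k,
    qFactorial_succ p (k + 1 + m)]
  have := qFactorial_ne_zero h0 h1 m
  have := qFactorial_ne_zero h0 h1 k
  have := qNumber_nat_ne_zero h0 h1 (Nat.succ_pos m)
  have := qNumber_nat_ne_zero h0 h1 (Nat.succ_pos k)
  have key := qNumber_add h0 h1 (k + 1) (m + 1)
  have e4 : k + 1 + m + 1 = k + 1 + (m + 1) := by omega
  rw [e4, key]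
  have e5 : ((k : ℤ) - ((k + 1 + m : ℕ) : ℤ)) = -((m + 1 : ℕ) : ℤ) := by push_cast; ring
  have e6 : ((k : ℤ) + 1) = ((k + 1 : ℕ) : ℤ) := by push_cast; ring
  rw [e5, e6]
  simp only [Nat.succ_eq_add_one] at *
  field_simp

lemma qNumber_inv (n : ℕ) : qNumber p⁻¹ (n : ℂ) = qNumber p (n : ℂ) := by
  rw [qNumber_nat, qNumber_nat, inv_pow, inv_inv, inv_inv, ← neg_sub (p ^ n), ← neg_sub p,
    neg_div_neg_eq]

lemma qBinomial_inv (n k : ℕ) : qBinomial p⁻¹ n k = qBinomial p n k := by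
  simp only [qBinomial, qFactorial, qNumber_inv]

variable {B : Type*} [Ring B] [Algebra ℂ B]

/-- Iterated `p`-commutators, a factorized form of `serreSum`. -/
def iterComm (p : ℂ) (a : ℤ) (x z : B) : ℕ → B
  | 0 => z
  | n + 1 => x * iterComm p a x z n - p ^ (-a - 2 * n) • (iterComm p a x z n * x)

lemma iterComm_eq (h0 : p ≠ 0)
    (h1 : ∀ n : ℕ, 0 < n → p ^ n ≠ 1) (a : ℤ) (x z : B) (n : ℕ) :
    iterComm p a x z n = ∑ k ∈ Finset.range (n + 1),
      ((-1) ^ k * qBinomial p n k * p ^ ((k : ℤ) * (-a - n + 1))) • (x ^ (n - k) * z * x ^ k) := by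
  induction n with
  | zero => simp [iterComm, qBinomial_zero h0 h1]
  | succ n ih =>
    rw [iterComm, ih, Finset.mul_sum, Finset.sum_mul, Finset.smul_sum]
    rw [Finset.sum_range_succ' _ n, Finset.sum_range_succ _ n]
    rw [Finset.sum_range_succ' _ (n + 1), Finset.sum_range_succ _ n]
    have hmid : ∀ k ∈ Finset.range n,
        x * (((-1) ^ (k + 1) * qBinomial p n (k + 1) *
            p ^ (((k + 1 : ℕ) : ℤ) * (-a - n + 1))) • (x ^ (n - (k + 1)) * z * x ^ (k + 1)))
        - p ^ (-a - 2 * n) • (((-1) ^ k * qBinomial p n k * p ^ ((k : ℤ) * (-a - n + 1))) •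
            (x ^ (n - k) * z * x ^ k) * x)
        = ((-1) ^ (k + 1) * qBinomial p (n + 1) (k + 1) *
            p ^ (((k + 1 : ℕ) : ℤ) * (-a - (n + 1 : ℕ) + 1))) •
            (x ^ (n + 1 - (k + 1)) * z * x ^ (k + 1)) := by
      intro k hk
      rw [Finset.mem_range] at hk
      have hx : x * (x ^ (n - (k + 1)) * z * x ^ (k + 1)) = x ^ (n - k) * z * x ^ (k + 1) := by
        rw [← mul_assoc, ← mul_assoc, ← pow_succ']
        congr 3; omega
      have hx' : x ^ (n - k) * z * x ^ k * x = x ^ (n - k) * z * x ^ (k + 1) := by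
        rw [mul_assoc _ _ x, ← pow_succ]
      rw [mul_smul_comm, smul_mul_assoc, hx, hx', smul_smul, ← sub_smul, Nat.add_sub_add_right,
        qBinomial_pascal h0 h1 hk]
      congr 1
      have z1 : p ^ (((k + 1 : ℕ) : ℤ) * (-a - n + 1)) =
          p ^ (((k + 1 : ℕ) : ℤ) * (-a - (n + 1 : ℕ) + 1)) * p ^ ((k : ℤ) + 1) := by
        rw [← zpow_add₀ h0]; congr 1; push_cast; ring
      have z2 : p ^ (-a - 2 * (n : ℤ)) * p ^ ((k : ℤ) * (-a - n + 1)) =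
          p ^ (((k + 1 : ℕ) : ℤ) * (-a - (n + 1 : ℕ) + 1)) * p ^ ((k : ℤ) - n) := by
        rw [← zpow_add₀ h0, ← zpow_add₀ h0]; congr 1; push_cast; ring
      rw [z1, pow_succ]
      linear_combination (-(-1) ^ k * qBinomial p n k) * z2
    rw [← Finset.sum_congr rfl hmid, Finset.sum_sub_distrib]
    have hlast : p ^ (-a - 2 * (n : ℤ)) • (((-1) ^ n * qBinomial p n n *
        p ^ ((n : ℤ) * (-a - n + 1))) • (x ^ (n - n) * z * x ^ n) * x) =
        - (((-1) ^ (n + 1) * qBinomial p (n + 1) (n + 1) *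
          p ^ (((n + 1 : ℕ) : ℤ) * (-a - (n + 1 : ℕ) + 1))) •
          (x ^ (n + 1 - (n + 1)) * z * x ^ (n + 1))) := by
      rw [smul_mul_assoc, smul_smul, ← neg_smul, qBinomial_self h0 h1, qBinomial_self h0 h1]
      have z2 : p ^ (-a - 2 * (n : ℤ)) * p ^ ((n : ℤ) * (-a - n + 1)) =
          p ^ (((n + 1 : ℕ) : ℤ) * (-a - (n + 1 : ℕ) + 1)) := by
        rw [← zpow_add₀ h0]; congr 1; push_cast; ring
      rw [← z2]
      simp only [Nat.sub_self, pow_zero, one_mul, mul_assoc, pow_succ]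
      congr 1
      ring
    rw [hlast]
    simp only [qBinomial_zero h0 h1, Nat.sub_zero, pow_zero, Nat.cast_zero, zero_mul, zpow_zero,
      mul_one, one_smul, ← mul_assoc, ← pow_succ']
    abel

lemma iterComm_eq_serreSum (h0 : p ≠ 0)
    (h1 : ∀ n : ℕ, 0 < n → p ^ n ≠ 1) {a : ℤ} (ha : a ≤ 0) (x z : B) :
    iterComm p a x z (1 - a).toNat = serreSum p (1 - a).toNat x z := by
  rw [iterComm_eq h0 h1, serreSum]
  refine Finset.sum_congr rfl fun k _ => ?_
  have : (-a - ((1 - a).toNat : ℤ) + 1) = 0 := by omega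
  rw [this]; simp

lemma iterComm_add (h0 : p ≠ 0) {a : ℤ} {x y z : B} (hyx : y * x = p ^ (-2 : ℤ) • (x * y))
    (hyz : y * z = p ^ (-a) • (z * y)) (n : ℕ) :
    iterComm p a (x + y) z n = iterComm p a x z n ∧
      y * iterComm p a x z n = p ^ (-a - 2 * n) • (iterComm p a x z n * y) := by
  induction n with
  | zero => simp [iterComm, hyz]
  | succ n ih =>
    obtain ⟨ih1, ih2⟩ := ih
    simp only [iterComm, ih1]
    set g := iterComm p a x z n
    constructor
    · rw [add_mul, mul_add, ih2, smul_add]; abel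
    · have z1 : p ^ (-a - 2 * ((n + 1 : ℕ) : ℤ)) = p ^ (-2 : ℤ) * p ^ (-a - 2 * (n : ℤ)) := by
        rw [← zpow_add₀ h0]; congr 1; push_cast; ring
      rw [mul_sub, ← mul_assoc, hyx, smul_mul_assoc, mul_assoc x y g, ih2, mul_smul_comm,
        mul_smul_comm, ← mul_assoc y g x, ih2, smul_mul_assoc, mul_assoc g y x, hyx, mul_smul_comm,
        z1, sub_mul, smul_sub, smul_smul, smul_mul_assoc]
      simp only [smul_smul, mul_assoc]
      congr 2; ring

lemma serreSum_add (h0 : p ≠ 0)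
    (h1 : ∀ n : ℕ, 0 < n → p ^ n ≠ 1) {a : ℤ} (ha : a ≤ 0) {x y z : B} (hyx : y * x = p ^ (-2 : ℤ) • (x * y))
    (hyz : y * z = p ^ (-a) • (z * y)) :
    serreSum p (1 - a).toNat (x + y) z = serreSum p (1 - a).toNat x z := by
  rw [← iterComm_eq_serreSum h0 h1 ha, ← iterComm_eq_serreSum h0 h1 ha,
    (iterComm_add h0 hyx hyz _).1]

lemma serreSum_inv (m : ℕ) (x z : B) : serreSum p⁻¹ m x z = serreSum p m x z := by
  simp only [serreSum, qBinomial_inv]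

lemma serreSum_add' (h0 : p ≠ 0)
    (h1 : ∀ n : ℕ, 0 < n → p ^ n ≠ 1) {a : ℤ} (ha : a ≤ 0) {x y z : B} (hyx : y * x = p ^ (2 : ℤ) • (x * y))
    (hyz : y * z = p ^ a • (z * y)) :
    serreSum p (1 - a).toNat (x + y) z = serreSum p (1 - a).toNat x z := by
  rw [← serreSum_inv, ← serreSum_inv _ x]
  refine serreSum_add (inv_ne_zero h0) (fun n hn h => h1 n hn ?_) ha ?_ ?_
  · rwa [inv_pow, inv_eq_one] at h
  · rw [hyx, inv_zpow', neg_neg]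
  · rw [hyz, inv_zpow', neg_neg]

end generic

section serre

variable {B : Type*} [Ring B] [Algebra ℂ B]

lemma serreSum_add_right (p : ℂ) (m : ℕ) (x z w : B) :
    serreSum p m x (z + w) = serreSum p m x z + serreSum p m x w := by
  simp only [serreSum, mul_add, add_mul, smul_add, Finset.sum_add_distrib]

lemma serreSum_smul (p : ℂ) (m : ℕ) (c d : ℂ) (x z : B) :
    serreSum p m (c • x) (d • z) = (c ^ m * d) • serreSum p m x z := by
  simp only [serreSum, Finset.smul_sum]
  refine Finset.sum_congr rfl fun k hk => ?_
  have hk : k ≤ m := by simpa [Nat.lt_succ_iff] using hk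
  simp only [smul_pow, smul_mul_assoc, mul_smul_comm, smul_smul]
  congr 1
  conv_rhs => rw [← Nat.sub_add_cancel hk, pow_add]
  rw [Nat.sub_add_cancel hk]; ring

lemma map_serreSum {C : Type*} [Ring C] [Algebra ℂ C] (φ : B →ₐ[ℂ] C) (p : ℂ) (m : ℕ) (x z : B) :
    φ (serreSum p m x z) = serreSum p m (φ x) (φ z) := by
  simp [serreSum, map_sum]

lemma twist_pow {α β : ℂ} {e z k l : B} (hke : k * e = α • (e * k)) (hkz : k * z = β • (z * k))
    (hle : l * e = β • (e * l)) (hkl : k * l = l * k) (n : ℕ) :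
    ∃ γ : ℂ, ∀ r s : ℕ, r + s = n →
      (e * k) ^ r * (z * l) * (e * k) ^ s = γ • (e ^ r * z * e ^ s * (k ^ n * l)) := by
  have hke' : ∀ s : ℕ, k ^ s * e = α ^ s • (e * k ^ s) := by
    intro s
    induction s with
    | zero => simp
    | succ s ih => rw [pow_succ, mul_assoc, hke, mul_smul_comm, ← mul_assoc, ih, smul_mul_assoc,
        smul_smul, pow_succ, mul_assoc, mul_comm α]
  have hke2 : ∀ s : ℕ, k * e ^ s = α ^ s • (e ^ s * k) := by
    intro s
    induction s with
    | zero => simp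
    | succ s ih => rw [pow_succ, ← mul_assoc, ih, smul_mul_assoc, mul_assoc (e ^ s), hke,
        mul_smul_comm, smul_smul, pow_succ, mul_assoc]
  have hkl' : ∀ s : ℕ, l * k ^ s = k ^ s * l := fun s =>
    ((show Commute k l from hkl).pow_left s).symm
  refine ⟨∏ i ∈ Finset.range n, (α ^ i * β), ?_⟩
  intro r
  induction r generalizing n with
  | zero =>
    intro s hs
    rw [zero_add] at hs
    subst hs
    induction s with
    | zero => simp
    | succ s ih =>
      rw [pow_succ, ← mul_assoc, ih, Finset.prod_range_succ, smul_mul_assoc, mul_smul]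
      congr 1
      simp only [pow_zero, one_mul]
      calc z * e ^ s * (k ^ s * l) * (e * k)
          = z * e ^ s * (k ^ s * (l * e) * k) := by simp only [mul_assoc]
        _ = β • (z * e ^ s * ((k ^ s * e) * (l * k))) := by
            rw [hle]; simp only [mul_smul_comm, smul_mul_assoc, mul_assoc]
        _ = (α ^ s * β) • (z * e ^ (s + 1) * (k ^ (s + 1) * l)) := by
            rw [hke', ← hkl]
            simp only [mul_smul_comm, smul_mul_assoc, mul_assoc, smul_smul, pow_succ]
            rw [mul_comm β]
  | succ r ih =>
    intro s hs
    obtain ⟨n, rfl⟩ : ∃ m, n = m + 1 := ⟨n - 1, by omega⟩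
    rw [pow_succ', mul_assoc (e * k), mul_assoc (e * k), ih n s (by omega), Finset.prod_range_succ,
      mul_smul_comm, mul_smul]
    congr 1
    calc e * k * (e ^ r * z * e ^ s * (k ^ n * l))
        = e * ((k * e ^ r) * z * e ^ s * (k ^ n * l)) := by simp only [mul_assoc]
      _ = α ^ r • (e * (e ^ r * (k * z) * e ^ s * (k ^ n * l))) := by
          rw [hke2]; simp only [mul_smul_comm, smul_mul_assoc, mul_assoc]
      _ = (α ^ r * β) • (e * (e ^ r * z * (k * e ^ s) * (k ^ n * l))) := by
          rw [hkz]; simp only [mul_smul_comm, smul_mul_assoc, mul_assoc, smul_smul]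
      _ = (α ^ n * β) • (e ^ (r + 1) * z * e ^ s * (k ^ (n + 1) * l)) := by
          rw [hke2]; simp only [mul_smul_comm, smul_mul_assoc, mul_assoc, smul_smul, pow_succ']
          congr 1
          rw [show n = r + s by omega, pow_add]; ring

lemma serreSum_twist (p : ℂ) (m : ℕ) {α β : ℂ} {e z k l : B} (hke : k * e = α • (e * k))
    (hkz : k * z = β • (z * k)) (hle : l * e = β • (e * l)) (hkl : k * l = l * k) :
    ∃ γ : ℂ, serreSum p m (e * k) (z * l) = γ • (serreSum p m e z * (k ^ m * l)) := by
  obtain ⟨γ, hγ⟩ := twist_pow hke hkz hle hkl m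
  refine ⟨γ, ?_⟩
  simp only [serreSum, Finset.sum_mul, Finset.smul_sum]
  refine Finset.sum_congr rfl fun i hi => ?_
  have hi : i ≤ m := by simpa [Nat.lt_succ_iff] using hi
  rw [hγ (m - i) i (by omega), smul_mul_assoc, smul_comm]

lemma serreSum_op (p : ℂ) (m : ℕ) (x z : B) :
    serreSum p m (MulOpposite.op x) (MulOpposite.op z) =
      (-1 : ℂ) ^ m • MulOpposite.op (serreSum p m x z) := by
  simp only [serreSum, Finset.op_sum, Finset.smul_sum]
  rw [← Finset.sum_range_reflect]
  refine Finset.sum_congr rfl fun i hi => ?_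
  have hi : i ≤ m := by simpa [Nat.lt_succ_iff] using hi
  have e1 : m + 1 - 1 - i = m - i := by omega
  rw [e1, qBinomial_symm hi, Nat.sub_sub_self hi, ← MulOpposite.op_smul, ← MulOpposite.op_pow,
    ← MulOpposite.op_pow, ← MulOpposite.op_mul, ← MulOpposite.op_mul, ← MulOpposite.op_smul,
    ← mul_assoc, smul_smul]
  congr 2
  have : (-1 : ℂ) ^ m = (-1) ^ (m - i) * (-1) ^ i := by rw [← pow_add, Nat.sub_add_cancel hi]
  have h2 : ((-1 : ℂ) ^ i) * (-1) ^ i = 1 := by rw [← mul_pow]; simp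
  rw [this]
  linear_combination (-(-1) ^ (m - i) * qBinomial p m i) * h2

end serre

/-! ### The quantized enveloping algebra -/

section algebra

/-- A symmetrizable generalized Cartan matrix `a` together with numbers `q_i`, stable under complex
conjugation and not roots of unity, such that `q_i ^ a_ij = q_j ^ a_ji`. -/
structure QuantumCartanDatum (I : Type*) where
  /-- the Cartan matrix `a_ij` -/
  a : I → I → ℤ
  /-- the numbers `q_i` -/
  qi : I → ℂ
  a_self : ∀ i, a i i = 2
  a_nonpos : ∀ i j, i ≠ j → a i j ≤ 0
  symm : ∀ i j, qi i ^ a i j = qi j ^ a j i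
  conj_qi : ∀ i, star (qi i) = qi i
  qi_ne_zero : ∀ i, qi i ≠ 0
  qi_pow_ne_one : ∀ i (n : ℕ), 0 < n → qi i ^ n ≠ 1

/-- The generators `E_i`, `F_i`, `K_i`, `K_i⁻¹`. -/
inductive Gen (I : Type*)
  | E (i : I)
  | F (i : I)
  | K (i : I)
  | Kinv (i : I)

variable {I : Type*} (D : QuantumCartanDatum I)

open FreeAlgebra in
/-- The defining relations of the quantized enveloping algebra. -/
inductive QRel : FreeAlgebra ℂ (Gen I) → FreeAlgebra ℂ (Gen I) → Prop
  | K_Kinv (i : I) : QRel (ι ℂ (.K i) * ι ℂ (.Kinv i)) 1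
  | Kinv_K (i : I) : QRel (ι ℂ (.Kinv i) * ι ℂ (.K i)) 1
  | K_K (i j : I) : QRel (ι ℂ (.K i) * ι ℂ (.K j)) (ι ℂ (.K j) * ι ℂ (.K i))
  | K_E (i j : I) :
      QRel (ι ℂ (.K i) * ι ℂ (.E j) * ι ℂ (.Kinv i)) (D.qi i ^ D.a i j • ι ℂ (.E j))
  | K_F (i j : I) :
      QRel (ι ℂ (.K i) * ι ℂ (.F j) * ι ℂ (.Kinv i)) (D.qi i ^ (-D.a i j) • ι ℂ (.F j))
  | E_F_same (i : I) :
      QRel (ι ℂ (.E i) * ι ℂ (.F i) - ι ℂ (.F i) * ι ℂ (.E i))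
        ((D.qi i - (D.qi i)⁻¹)⁻¹ • (ι ℂ (.K i) - ι ℂ (.Kinv i)))
  | E_F_ne (i j : I) (hij : i ≠ j) :
      QRel (ι ℂ (.E i) * ι ℂ (.F j) - ι ℂ (.F j) * ι ℂ (.E i)) 0
  | serre_E (i j : I) (hij : i ≠ j) :
      QRel (serreSum (D.qi i) (1 - D.a i j).toNat (ι ℂ (.E i)) (ι ℂ (.E j))) 0
  | serre_F (i j : I) (hij : i ≠ j) :
      QRel (serreSum (D.qi i) (1 - D.a i j).toNat (ι ℂ (.F i)) (ι ℂ (.F j))) 0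

/-- The quantized enveloping algebra `U_q(𝔤)`. -/
def Uq : Type _ := RingQuot (QRel D)

namespace Uq

instance : Ring (Uq D) := inferInstanceAs (Ring (RingQuot (QRel D)))
instance : Algebra ℂ (Uq D) := inferInstanceAs (Algebra ℂ (RingQuot (QRel D)))

/-- The class of an element of the free algebra. -/
def mk : FreeAlgebra ℂ (Gen I) →ₐ[ℂ] Uq D := RingQuot.mkAlgHom ℂ (QRel D)

def E (i : I) : Uq D := mk D (FreeAlgebra.ι ℂ (.E i))
def F (i : I) : Uq D := mk D (FreeAlgebra.ι ℂ (.F i))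
def K (i : I) : Uq D := mk D (FreeAlgebra.ι ℂ (.K i))
def Kinv (i : I) : Uq D := mk D (FreeAlgebra.ι ℂ (.Kinv i))

variable {D} in
lemma mk_rel {x y : FreeAlgebra ℂ (Gen I)} (h : QRel D x y) : mk D x = mk D y :=
  RingQuot.mkAlgHom_rel ℂ h

/-- Elements of an algebra that satisfy the defining relations. -/
structure Realization {B : Type*} [Ring B] [Algebra ℂ B] (e f k k' : I → B) : Prop where
  K_Kinv : ∀ i, k i * k' i = 1
  Kinv_K : ∀ i, k' i * k i = 1
  K_K : ∀ i j, k i * k j = k j * k i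
  K_E : ∀ i j, k i * e j = D.qi i ^ D.a i j • (e j * k i)
  K_F : ∀ i j, k i * f j = D.qi i ^ (-D.a i j) • (f j * k i)
  E_F_same : ∀ i, e i * f i - f i * e i = (D.qi i - (D.qi i)⁻¹)⁻¹ • (k i - k' i)
  E_F_ne : ∀ i j, i ≠ j → e i * f j - f j * e i = 0
  serre_E : ∀ i j, i ≠ j → serreSum (D.qi i) (1 - D.a i j).toNat (e i) (e j) = 0
  serre_F : ∀ i j, i ≠ j → serreSum (D.qi i) (1 - D.a i j).toNat (f i) (f j) = 0

lemma realization : Realization D (E D) (F D) (K D) (Kinv D) where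
  K_Kinv i := by simpa [K, Kinv] using mk_rel (QRel.K_Kinv (D := D) i)
  Kinv_K i := by simpa [K, Kinv] using mk_rel (QRel.Kinv_K (D := D) i)
  K_K i j := by simpa [K] using mk_rel (QRel.K_K (D := D) i j)
  K_E i j := by
    have h := mk_rel (QRel.K_E (D := D) i j)
    have h' : Kinv D i * K D i = 1 := by simpa [K, Kinv] using mk_rel (QRel.Kinv_K (D := D) i)
    simp only [map_mul, map_smul] at h
    rw [← smul_mul_assoc]
    change mk D _ * mk D _ * Kinv D i = _ at h
    rw [E, ← h, mul_assoc _ _ (K D i), h', mul_one, K]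
  K_F i j := by
    have h := mk_rel (QRel.K_F (D := D) i j)
    have h' : Kinv D i * K D i = 1 := by simpa [K, Kinv] using mk_rel (QRel.Kinv_K (D := D) i)
    simp only [map_mul, map_smul] at h
    rw [← smul_mul_assoc]
    change mk D _ * mk D _ * Kinv D i = _ at h
    rw [F, ← h, mul_assoc _ _ (K D i), h', mul_one, K]
  E_F_same i := by simpa [E, F, K, Kinv] using mk_rel (QRel.E_F_same (D := D) i)
  E_F_ne i j h := by simpa [E, F, K, Kinv] using mk_rel (QRel.E_F_ne (D := D) i j h)
  serre_E i j h := by simpa [E, map_serreSum] using mk_rel (QRel.serre_E (D := D) i j h)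
  serre_F i j h := by simpa [F, map_serreSum] using mk_rel (QRel.serre_F (D := D) i j h)

/-- The map from generators given by four families. -/
def genMap {B : Type*} (e f k k' : I → B) : Gen I → B
  | .E i => e i
  | .F i => f i
  | .K i => k i
  | .Kinv i => k' i

variable {D}

/-- The universal property of `U_q(𝔤)`. -/
def lift {B : Type*} [Ring B] [Algebra ℂ B] {e f k k' : I → B} (h : Realization D e f k k') :
    Uq D →ₐ[ℂ] B :=
  RingQuot.liftAlgHom ℂ ⟨FreeAlgebra.lift ℂ (genMap e f k k'), by
    have hE : ∀ i j, k i * (e j * k' i) = D.qi i ^ D.a i j • e j := fun i j => by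
      rw [← mul_assoc, h.K_E, smul_mul_assoc, mul_assoc, h.K_Kinv, mul_one]
    have hF : ∀ i j, k i * (f j * k' i) = D.qi i ^ (-D.a i j) • f j := fun i j => by
      rw [← mul_assoc, h.K_F, smul_mul_assoc, mul_assoc, h.K_Kinv, mul_one]
    intro x y hxy
    induction hxy with
    | K_Kinv i => simp [genMap, h.K_Kinv]
    | Kinv_K i => simp [genMap, h.Kinv_K]
    | K_K i j => simp [genMap, h.K_K i j]
    | K_E i j => simp [genMap, mul_assoc, hE]
    | K_F i j => simp [genMap, mul_assoc, hF, -zpow_neg]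
    | E_F_same i => simp [genMap, h.E_F_same i]
    | E_F_ne i j hij => simp [genMap, h.E_F_ne i j hij]
    | serre_E i j hij => simp [map_serreSum, genMap, h.serre_E i j hij]
    | serre_F i j hij => simp [map_serreSum, genMap, h.serre_F i j hij]⟩

lemma lift_mk {B : Type*} [Ring B] [Algebra ℂ B] {e f k k' : I → B} (h : Realization D e f k k')
    (x : FreeAlgebra ℂ (Gen I)) : lift h (mk D x) = FreeAlgebra.lift ℂ (genMap e f k k') x :=
  RingQuot.liftAlgHom_mkAlgHom_apply ..

lemma mk_surjective : Function.Surjective (mk D) := RingQuot.mkAlgHom_surjective ℂ (QRel D)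

section lift

variable {B : Type*} [Ring B] [Algebra ℂ B] {e f k k' : I → B} (h : Realization D e f k k')

@[simp] lemma lift_E (i : I) : lift h (E D i) = e i := by
  rw [E, lift_mk, FreeAlgebra.lift_ι_apply]; rfl
@[simp] lemma lift_F (i : I) : lift h (F D i) = f i := by
  rw [F, lift_mk, FreeAlgebra.lift_ι_apply]; rfl
@[simp] lemma lift_K (i : I) : lift h (K D i) = k i := by
  rw [K, lift_mk, FreeAlgebra.lift_ι_apply]; rfl
@[simp] lemma lift_Kinv (i : I) : lift h (Kinv D i) = k' i := by
  rw [Kinv, lift_mk, FreeAlgebra.lift_ι_apply]; rfl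

end lift

lemma algHom_ext {B : Type*} [Ring B] [Algebra ℂ B] {φ ψ : Uq D →ₐ[ℂ] B}
    (hE : ∀ i, φ (E D i) = ψ (E D i)) (hF : ∀ i, φ (F D i) = ψ (F D i))
    (hK : ∀ i, φ (K D i) = ψ (K D i)) (hKinv : ∀ i, φ (Kinv D i) = ψ (Kinv D i)) : φ = ψ := by
  apply RingQuot.ringQuot_ext'
  apply FreeAlgebra.hom_ext
  funext g
  cases g with
  | E i => exact hE i
  | F i => exact hF i
  | K i => exact hK i
  | Kinv i => exact hKinv i

@[elab_as_elim]
lemma induction {p : Uq D → Prop} (hc : ∀ c : ℂ, p (algebraMap ℂ _ c)) (hE : ∀ i, p (E D i))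
    (hF : ∀ i, p (F D i)) (hK : ∀ i, p (K D i)) (hKinv : ∀ i, p (Kinv D i))
    (hmul : ∀ x y, p x → p y → p (x * y)) (hadd : ∀ x y, p x → p y → p (x + y)) (x : Uq D) :
    p x := by
  obtain ⟨x, rfl⟩ := mk_surjective x
  induction x with
  | grade0 c => simpa using hc c
  | grade1 g =>
    cases g with
    | E i => exact hE i
    | F i => exact hF i
    | K i => exact hK i
    | Kinv i => exact hKinv i
  | mul x y hx hy => simpa using hmul _ _ hx hy
  | add x y hx hy => simpa using hadd _ _ hx hy

/-! ### Consequences of the relations -/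

namespace Realization

variable {B : Type*} [Ring B] [Algebra ℂ B] {e f k k' : I → B}

lemma Kinv_comm (h : Realization D e f k k') {x : B} {i : I} {c : ℂ} (hc : c ≠ 0) (hx : k i * x = c • (x * k i)) :
    k' i * x = c⁻¹ • (x * k' i) := by
  have h1 : k' i * (k i * x) * k' i = c • (k' i * (x * k i) * k' i) := by rw [hx]; simp
  have h2 : k' i * (k i * x) * k' i = x * k' i := by
    rw [← mul_assoc, h.Kinv_K, one_mul]
  have h3 : k' i * (x * k i) * k' i = k' i * x := by
    rw [mul_assoc, mul_assoc x, h.K_Kinv, mul_one]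
  rw [h2, h3] at h1
  rw [h1, smul_smul, inv_mul_cancel₀ hc, one_smul]

lemma Kinv_E (h : Realization D e f k k') (i j : I) : k' i * e j = D.qi i ^ (-D.a i j) • (e j * k' i) := by
  rw [zpow_neg]; exact h.Kinv_comm (zpow_ne_zero _ (D.qi_ne_zero i)) (h.K_E i j)

lemma Kinv_F (h : Realization D e f k k') (i j : I) : k' i * f j = D.qi i ^ (D.a i j) • (f j * k' i) := by
  have := h.Kinv_comm (zpow_ne_zero _ (D.qi_ne_zero i)) (h.K_F i j)
  rwa [← zpow_neg, neg_neg] at this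

lemma Kinv_K' (h : Realization D e f k k') (i j : I) : k' i * k j = k j * k' i := by
  have := h.Kinv_comm (x := k j) (i := i) (c := 1) one_ne_zero (by simpa using h.K_K i j)
  simpa using this

lemma Kinv_Kinv (h : Realization D e f k k') (i j : I) : k' i * k' j = k' j * k' i := by
  have := h.Kinv_comm (x := k' j) (i := i) one_ne_zero (by rw [one_smul, ← h.Kinv_K' j i])
  simpa using this

end Realization

/-! ### The Hopf algebra structure -/

lemma realization_comul : Realization D
    (fun i => E D i ⊗ₜ[ℂ] K D i + 1 ⊗ₜ[ℂ] E D i)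
    (fun i => F D i ⊗ₜ[ℂ] (1 : Uq D) + Kinv D i ⊗ₜ[ℂ] F D i)
    (fun i => K D i ⊗ₜ[ℂ] K D i) (fun i => Kinv D i ⊗ₜ[ℂ] Kinv D i) := by
  have h := realization D
  constructor
  · intro i; simp [h.K_Kinv, Algebra.TensorProduct.one_def]
  · intro i; simp [h.Kinv_K, Algebra.TensorProduct.one_def]
  · intro i j; simp [h.K_K i j]
  · intro i j
    simp only [mul_add, add_mul, Algebra.TensorProduct.tmul_mul_tmul, h.K_E i j, h.K_K i j, mul_one,
      one_mul, smul_add, TensorProduct.smul_tmul', TensorProduct.tmul_smul]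
  · intro i j
    simp only [mul_add, add_mul, Algebra.TensorProduct.tmul_mul_tmul, h.K_F i j, h.Kinv_K' j i,
      mul_one, one_mul, smul_add, TensorProduct.smul_tmul', TensorProduct.tmul_smul]
  · intro i
    have e1 := h.E_F_same i
    rw [sub_eq_iff_eq_add] at e1
    simp only [mul_add, add_mul, Algebra.TensorProduct.tmul_mul_tmul, mul_one, one_mul, e1,
      h.K_F i i, h.Kinv_E i i, TensorProduct.smul_tmul', TensorProduct.tmul_smul,
      TensorProduct.add_tmul, TensorProduct.tmul_add, TensorProduct.sub_tmul, TensorProduct.tmul_sub,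
      smul_sub]
    abel
  · intro i j hij
    have e1 := h.E_F_ne i j hij
    rw [sub_eq_zero] at e1
    simp only [mul_add, add_mul, Algebra.TensorProduct.tmul_mul_tmul, mul_one, one_mul, e1,
      h.K_F i j, h.Kinv_E j i, TensorProduct.smul_tmul', TensorProduct.tmul_smul, zpow_neg,
      D.symm i j]
    abel
  · intro i j hij
    have h0 := D.qi_ne_zero i
    have h1 := D.qi_pow_ne_one i
    have ha := D.a_nonpos i j hij
    rw [serreSum_add_right]
    have s1 : serreSum (D.qi i) (1 - D.a i j).toNat
        (E D i ⊗ₜ[ℂ] K D i + 1 ⊗ₜ[ℂ] E D i) (E D j ⊗ₜ[ℂ] K D j) = 0 := by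
      rw [serreSum_add h0 h1 ha]
      · have : serreSum (D.qi i) (1 - D.a i j).toNat (E D i ⊗ₜ[ℂ] K D i) (E D j ⊗ₜ[ℂ] K D j) =
            serreSum (D.qi i) (1 - D.a i j).toNat (E D i) (E D j) ⊗ₜ[ℂ]
              (K D i ^ (1 - D.a i j).toNat * K D j) := by
          simp only [serreSum, TensorProduct.sum_tmul]
          refine Finset.sum_congr rfl fun k hk => ?_
          have hk : k ≤ (1 - D.a i j).toNat := by simpa [Nat.lt_succ_iff] using hk
          simp only [Algebra.TensorProduct.tmul_pow, Algebra.TensorProduct.tmul_mul_tmul,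
            TensorProduct.smul_tmul']
          congr 1
          rw [mul_assoc, ((show Commute (K D j) (K D i) from h.K_K j i).pow_right k).eq,
            ← mul_assoc, ← pow_add, Nat.sub_add_cancel hk]
        rw [this, h.serre_E i j hij, TensorProduct.zero_tmul]
      · have := h.K_E i i
        rw [D.a_self] at this
        simp only [Algebra.TensorProduct.tmul_mul_tmul, mul_one, one_mul, this,
          TensorProduct.tmul_smul, smul_smul, zpow_neg]
        rw [inv_mul_cancel₀ (zpow_ne_zero _ h0), one_smul]
      · simp only [Algebra.TensorProduct.tmul_mul_tmul, mul_one, one_mul, h.K_E j i,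
          TensorProduct.tmul_smul, smul_smul, zpow_neg, ← D.symm i j]
        rw [inv_mul_cancel₀ (zpow_ne_zero _ h0), one_smul]
    have s2 : serreSum (D.qi i) (1 - D.a i j).toNat
        (E D i ⊗ₜ[ℂ] K D i + 1 ⊗ₜ[ℂ] E D i) ((1 : Uq D) ⊗ₜ[ℂ] E D j) = 0 := by
      rw [add_comm, serreSum_add' h0 h1 ha]
      · have := map_serreSum (Algebra.TensorProduct.includeRight : Uq D →ₐ[ℂ] Uq D ⊗[ℂ] Uq D)
          (D.qi i) (1 - D.a i j).toNat (E D i) (E D j)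
        simp only [Algebra.TensorProduct.includeRight_apply] at this
        rw [← this, h.serre_E i j hij, TensorProduct.tmul_zero]
      · have := h.K_E i i
        rw [D.a_self] at this
        simp only [Algebra.TensorProduct.tmul_mul_tmul, mul_one, one_mul, this,
          TensorProduct.tmul_smul]
      · simp only [Algebra.TensorProduct.tmul_mul_tmul, mul_one, one_mul, h.K_E i j,
          TensorProduct.tmul_smul]
    rw [s1, s2, add_zero]
  · intro i j hij
    have h0 := D.qi_ne_zero i
    have h1 := D.qi_pow_ne_one i
    have ha := D.a_nonpos i j hij
    rw [serreSum_add_right]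
    have s1 : serreSum (D.qi i) (1 - D.a i j).toNat
        (F D i ⊗ₜ[ℂ] (1 : Uq D) + Kinv D i ⊗ₜ[ℂ] F D i) (F D j ⊗ₜ[ℂ] (1 : Uq D)) = 0 := by
      rw [serreSum_add' h0 h1 ha]
      · have := map_serreSum (Algebra.TensorProduct.includeLeft : Uq D →ₐ[ℂ] Uq D ⊗[ℂ] Uq D)
          (D.qi i) (1 - D.a i j).toNat (F D i) (F D j)
        simp only [Algebra.TensorProduct.includeLeft_apply] at this
        rw [← this, h.serre_F i j hij, TensorProduct.zero_tmul]
      · have := h.Kinv_F i i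
        rw [D.a_self] at this
        simp only [Algebra.TensorProduct.tmul_mul_tmul, mul_one, one_mul, this,
          TensorProduct.smul_tmul']
      · simp only [Algebra.TensorProduct.tmul_mul_tmul, mul_one, one_mul, h.Kinv_F i j,
          TensorProduct.smul_tmul']
    have s2 : serreSum (D.qi i) (1 - D.a i j).toNat
        (F D i ⊗ₜ[ℂ] (1 : Uq D) + Kinv D i ⊗ₜ[ℂ] F D i) (Kinv D j ⊗ₜ[ℂ] F D j) = 0 := by
      rw [add_comm, serreSum_add h0 h1 ha]
      · have : serreSum (D.qi i) (1 - D.a i j).toNat (Kinv D i ⊗ₜ[ℂ] F D i)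
            (Kinv D j ⊗ₜ[ℂ] F D j) = (Kinv D i ^ (1 - D.a i j).toNat * Kinv D j) ⊗ₜ[ℂ]
            serreSum (D.qi i) (1 - D.a i j).toNat (F D i) (F D j) := by
          simp only [serreSum, TensorProduct.tmul_sum]
          refine Finset.sum_congr rfl fun k hk => ?_
          have hk : k ≤ (1 - D.a i j).toNat := by simpa [Nat.lt_succ_iff] using hk
          simp only [Algebra.TensorProduct.tmul_pow, Algebra.TensorProduct.tmul_mul_tmul,
            TensorProduct.tmul_smul]
          congr 2
          rw [mul_assoc, ((show Commute (Kinv D j) (Kinv D i) from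
            h.Kinv_Kinv j i).pow_right k).eq, ← mul_assoc, ← pow_add, Nat.sub_add_cancel hk]
        rw [this, h.serre_F i j hij, TensorProduct.tmul_zero]
      · have := h.Kinv_F i i
        rw [D.a_self] at this
        simp only [Algebra.TensorProduct.tmul_mul_tmul, mul_one, one_mul, this,
          TensorProduct.smul_tmul', smul_smul, zpow_neg]
        rw [inv_mul_cancel₀ (zpow_ne_zero _ h0), one_smul]
      · simp only [Algebra.TensorProduct.tmul_mul_tmul, mul_one, one_mul, h.Kinv_F j i,
          TensorProduct.smul_tmul', smul_smul, zpow_neg, ← D.symm i j]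
        rw [inv_mul_cancel₀ (zpow_ne_zero _ h0), one_smul]
    rw [s1, s2, add_zero]

lemma serreSum_zero_right {B : Type*} [Ring B] [Algebra ℂ B] (p : ℂ) (m : ℕ) (x : B) :
    serreSum p m x 0 = 0 := by
  simp [serreSum]

lemma realization_counit : Realization D (fun _ => (0 : ℂ)) (fun _ => 0) (fun _ => 1)
    (fun _ => 1) := by
  constructor <;> intros <;> simp [serreSum_zero_right]

lemma realization_antipode : Realization D
    (fun i => MulOpposite.op (-(E D i * Kinv D i))) (fun i => MulOpposite.op (-(K D i * F D i)))
    (fun i => MulOpposite.op (Kinv D i)) (fun i => MulOpposite.op (K D i)) := by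
  have h := realization D
  have hm : ∀ {B : Type _} [Ring B] [Algebra ℂ B] (x : B), -x = (-1 : ℂ) • x := by
    intros; simp
  constructor
  · intro i; rw [← MulOpposite.op_mul, h.K_Kinv]; rfl
  · intro i; rw [← MulOpposite.op_mul, h.Kinv_K]; rfl
  · intro i j; rw [← MulOpposite.op_mul, h.Kinv_Kinv j i]; rfl
  · intro i j
    rw [← MulOpposite.op_mul, ← MulOpposite.op_mul, ← MulOpposite.op_smul]
    congr 1
    rw [mul_neg, neg_mul, smul_neg, ← mul_assoc, h.Kinv_E i j, smul_mul_assoc, smul_smul,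
      ← zpow_add₀ (D.qi_ne_zero i), add_neg_cancel, zpow_zero, one_smul, mul_assoc, mul_assoc,
      h.Kinv_Kinv i j]
  · intro i j
    rw [← MulOpposite.op_mul, ← MulOpposite.op_mul, ← MulOpposite.op_smul]
    congr 1
    have : Kinv D i * (K D j * F D j) = D.qi i ^ D.a i j • (K D j * F D j * Kinv D i) := by
      rw [← mul_assoc, h.Kinv_K' i j, mul_assoc, h.Kinv_F i j, mul_smul_comm, mul_assoc]
    rw [mul_neg, neg_mul, smul_neg, this, smul_smul, ← zpow_add₀ (D.qi_ne_zero i), neg_add_cancel,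
      zpow_zero, one_smul]
  · intro i
    have e1 := h.E_F_same i
    rw [← MulOpposite.op_mul, ← MulOpposite.op_mul, ← MulOpposite.op_sub, ← MulOpposite.op_sub,
      ← MulOpposite.op_smul]
    congr 1
    have t1 : K D i * F D i * (E D i * Kinv D i) = F D i * E D i := by
      have : K D i * F D i * (E D i * Kinv D i) = (K D i * F D i) * E D i * Kinv D i := by
        simp only [mul_assoc]
      rw [this, h.K_F, smul_mul_assoc, mul_assoc (F D i), h.K_E, mul_smul_comm, smul_smul,
        ← zpow_add₀ (D.qi_ne_zero i), neg_add_cancel, zpow_zero, one_smul, mul_assoc, mul_assoc,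
        h.K_Kinv, mul_one]
    have t2 : E D i * Kinv D i * (K D i * F D i) = E D i * F D i := by
      rw [mul_assoc, ← mul_assoc (Kinv D i), h.Kinv_K, one_mul]
    rw [neg_mul_neg, neg_mul_neg, t1, t2, ← neg_sub, e1, ← smul_neg, neg_sub]
  · intro i j hij
    have e1 := h.E_F_ne i j hij
    rw [← MulOpposite.op_mul, ← MulOpposite.op_mul, ← MulOpposite.op_sub, neg_mul_neg, neg_mul_neg]
    rw [sub_eq_zero] at e1
    have t1 : K D j * F D j * (E D i * Kinv D i) =
        D.qi j ^ D.a j i • (E D i * K D j * F D j * Kinv D i) := by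
      calc K D j * F D j * (E D i * Kinv D i) = K D j * (F D j * E D i) * Kinv D i := by
            simp only [mul_assoc]
        _ = K D j * E D i * F D j * Kinv D i := by rw [← e1]; simp only [mul_assoc]
        _ = _ := by rw [h.K_E, smul_mul_assoc, smul_mul_assoc]
    have t2 : E D i * Kinv D i * (K D j * F D j) =
        D.qi i ^ D.a i j • (E D i * K D j * F D j * Kinv D i) := by
      calc E D i * Kinv D i * (K D j * F D j) = E D i * (Kinv D i * K D j) * F D j := by
            simp only [mul_assoc]
        _ = E D i * K D j * (Kinv D i * F D j) := by rw [h.Kinv_K']; simp only [mul_assoc]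
        _ = _ := by rw [h.Kinv_F, mul_smul_comm]; simp only [mul_assoc]
    rw [t1, t2, D.symm i j, sub_self, MulOpposite.op_zero]
  · intro i j hij
    obtain ⟨γ, hγ⟩ := serreSum_twist (D.qi i) (1 - D.a i j).toNat (h.Kinv_E i i) (h.Kinv_E i j)
      (by rw [h.Kinv_E j i, zpow_neg, ← D.symm i j, ← zpow_neg]) (h.Kinv_Kinv i j)
    rw [serreSum_op, hm (E D i * Kinv D i), hm (E D j * Kinv D j), serreSum_smul, hγ,
      h.serre_E i j hij]
    simp
  · intro i j hij
    obtain ⟨γ, hγ⟩ := serreSum_twist (D.qi i) (1 - D.a i j).toNat (h.K_F i i) (h.K_F i j)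
      (by rw [h.K_F j i, zpow_neg, ← D.symm i j, ← zpow_neg]) (h.K_K i j)
    rw [serreSum_op, hm (K D i * F D i), hm (K D j * F D j), h.K_F i i, h.K_F j j, smul_smul,
      smul_smul, serreSum_smul, hγ, h.serre_F i j hij]
    simp

/-- The comultiplication `Δ`. -/
def comulHom : Uq D →ₐ[ℂ] Uq D ⊗[ℂ] Uq D := lift realization_comul

/-- The counit `ε`. -/
def counitHom : Uq D →ₐ[ℂ] ℂ := lift realization_counit

/-- The antipode `S`, as an algebra homomorphism into the opposite algebra. -/
def antipodeHom : Uq D →ₐ[ℂ] (Uq D)ᵐᵒᵖ := lift realization_antipode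

/-- The antipode `S`. -/
def antipode : Uq D →ₗ[ℂ] Uq D :=
  (MulOpposite.opLinearEquiv ℂ).symm.toLinearMap ∘ₗ antipodeHom.toLinearMap

lemma antipode_mul (x y : Uq D) : antipode (x * y) = antipode y * antipode x := by
  simp [antipode]

@[simp] lemma antipode_E (i : I) : antipode (E D i) = -(E D i * Kinv D i) := by
  simp [antipode, antipodeHom]
@[simp] lemma antipode_F (i : I) : antipode (F D i) = -(K D i * F D i) := by
  simp [antipode, antipodeHom]
@[simp] lemma antipode_K (i : I) : antipode (K D i) = Kinv D i := by
  simp [antipode, antipodeHom]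
@[simp] lemma antipode_Kinv (i : I) : antipode (Kinv D i) = K D i := by
  simp [antipode, antipodeHom]
@[simp] lemma antipode_algebraMap (c : ℂ) :
    antipode (algebraMap ℂ (Uq D) c) = algebraMap ℂ (Uq D) c := by
  simp only [antipode, LinearMap.comp_apply, AlgHom.toLinearMap_apply, AlgHom.commutes]
  rfl

lemma antipode_one : antipode (1 : Uq D) = 1 := by
  simpa using antipode_algebraMap (D := D) 1

instance : Bialgebra ℂ (Uq D) :=
  Bialgebra.ofAlgHom comulHom counitHom
    (by
      apply algHom_ext <;> intro i <;>
        simp [comulHom, TensorProduct.add_tmul, TensorProduct.tmul_add, add_assoc,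
          Algebra.TensorProduct.one_def])
    (by
      apply algHom_ext <;> intro i <;> simp [comulHom, counitHom])
    (by
      apply algHom_ext <;> intro i <;> simp [comulHom, counitHom])

lemma comul_apply (x : Uq D) : Coalgebra.comul (R := ℂ) x = comulHom x := rfl

lemma counit_apply (x : Uq D) : Coalgebra.counit (R := ℂ) x = counitHom x := rfl

lemma mul_antipode_rTensor (x : Uq D) (w : Uq D ⊗[ℂ] Uq D)
    (hx : LinearMap.mul' ℂ (Uq D) (antipode.rTensor _ (comulHom x)) = algebraMap ℂ _ (counitHom x)) :
    LinearMap.mul' ℂ (Uq D) (antipode.rTensor _ (comulHom x * w)) =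
      counitHom x • LinearMap.mul' ℂ (Uq D) (antipode.rTensor _ w) := by
  induction w with
  | zero => simp
  | add w w' hw hw' => simp only [mul_add, map_add, hw, hw', smul_add]
  | tmul a b =>
    have key : ∀ v : Uq D ⊗[ℂ] Uq D,
        LinearMap.mul' ℂ (Uq D) (antipode.rTensor _ (v * a ⊗ₜ[ℂ] b)) =
          antipode a * LinearMap.mul' ℂ (Uq D) (antipode.rTensor _ v) * b := by
      intro v
      induction v with
      | zero => simp
      | add v v' hv hv' => simp only [add_mul, mul_add, map_add, hv, hv']
      | tmul c d => simp [antipode_mul, mul_assoc]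
    rw [key, hx, ← Algebra.commutes, mul_assoc, ← Algebra.smul_def]
    simp

lemma mul_antipode_lTensor (x : Uq D) (w : Uq D ⊗[ℂ] Uq D)
    (hx : LinearMap.mul' ℂ (Uq D) (antipode.lTensor _ (comulHom x)) = algebraMap ℂ _ (counitHom x)) :
    LinearMap.mul' ℂ (Uq D) (antipode.lTensor _ (w * comulHom x)) =
      counitHom x • LinearMap.mul' ℂ (Uq D) (antipode.lTensor _ w) := by
  induction w with
  | zero => simp
  | add w w' hw hw' => simp only [add_mul, map_add, hw, hw', smul_add]
  | tmul a b =>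
    have key : ∀ v : Uq D ⊗[ℂ] Uq D,
        LinearMap.mul' ℂ (Uq D) (antipode.lTensor _ (a ⊗ₜ[ℂ] b * v)) =
          a * LinearMap.mul' ℂ (Uq D) (antipode.lTensor _ v) * antipode b := by
      intro v
      induction v with
      | zero => simp
      | add v v' hv hv' => simp only [add_mul, mul_add, map_add, hv, hv']
      | tmul c d => simp [antipode_mul, mul_assoc]
    rw [key, hx, ← Algebra.commutes, mul_assoc, ← Algebra.smul_def]
    simp

instance : HopfAlgebra ℂ (Uq D) where
  antipode := antipode
  mul_antipode_rTensor_comul := by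
    have h := realization D
    ext x
    change LinearMap.mul' ℂ (Uq D) (antipode.rTensor _ (comulHom x)) =
      algebraMap ℂ _ (counitHom x)
    induction x using induction with
    | hc c => simp [Algebra.TensorProduct.algebraMap_apply]
    | hE i => simp [comulHom, counitHom, mul_assoc, h.Kinv_K, antipode_one]
    | hF i => simp [comulHom, counitHom]
    | hK i => simp [comulHom, counitHom, h.Kinv_K]
    | hKinv i => simp [comulHom, counitHom, h.K_Kinv]
    | hmul x y hx hy =>
      rw [map_mul, mul_antipode_rTensor x _ hx, hy, map_mul, map_mul, Algebra.smul_def]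
    | hadd x y hx hy => simp [hx, hy]
  mul_antipode_lTensor_comul := by
    have h := realization D
    ext x
    change LinearMap.mul' ℂ (Uq D) (antipode.lTensor _ (comulHom x)) =
      algebraMap ℂ _ (counitHom x)
    induction x using induction with
    | hc c => simp [Algebra.TensorProduct.algebraMap_apply, antipode_one]
    | hE i => simp [comulHom, counitHom]
    | hF i => simp [comulHom, counitHom, ← mul_assoc, h.Kinv_K, antipode_one]
    | hK i => simp [comulHom, counitHom, h.K_Kinv]
    | hKinv i => simp [comulHom, counitHom, h.Kinv_K]
    | hmul x y hx hy =>
      rw [map_mul, mul_antipode_lTensor y _ hy, hx, map_mul, Algebra.smul_def, ← map_mul,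
        mul_comm]
    | hadd x y hx hy => simp [hx, hy]

end Uq

end algebra

section coordinateRing

variable {I : Type*} {D : QuantumCartanDatum I}

/-! ### The compact real form -/

/-- The opposite algebra with complex conjugate scalar multiplication. -/
def ConjOp (B : Type*) : Type _ := Bᵐᵒᵖ

namespace ConjOp

variable {B : Type*} [Ring B] [Algebra ℂ B]

instance : Ring (ConjOp B) := inferInstanceAs (Ring Bᵐᵒᵖ)

instance : Algebra ℂ (ConjOp B) :=
  RingHom.toAlgebra' ((algebraMap ℂ Bᵐᵒᵖ).comp (starRingEnd ℂ)) fun c x =>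
    Algebra.commutes (A := Bᵐᵒᵖ) (starRingEnd ℂ c) x

/-- The identity map into `ConjOp`. -/
def of : Bᵐᵒᵖ ≃+* ConjOp B := RingEquiv.refl _

lemma smul_of (c : ℂ) (x : Bᵐᵒᵖ) : c • of x = of (starRingEnd ℂ c • x) := by
  rw [Algebra.smul_def, Algebra.smul_def]; rfl

lemma algebraMap_eq (c : ℂ) :
    algebraMap ℂ (ConjOp B) c = of (algebraMap ℂ Bᵐᵒᵖ (starRingEnd ℂ c)) := rfl

end ConjOp

lemma conj_qBinomial {p : ℂ} (hp : star p = p) (n k : ℕ) :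
    starRingEnd ℂ (qBinomial p n k) = qBinomial p n k := by
  have h : ∀ n : ℕ, starRingEnd ℂ (qNumber p (n : ℂ)) = qNumber p (n : ℂ) := by
    intro n
    have hp' : starRingEnd ℂ p = p := hp
    rw [qNumber_nat]; simp [hp']
  simp [qBinomial, qFactorial, map_prod, -Nat.cast_add, h]

namespace Uq

lemma Realization.chevalley {B : Type*} [Ring B] [Algebra ℂ B] {e f k k' : I → B}
    (h : Realization D e f k k') :
    Realization D (fun i => -f i) (fun i => -e i) k' k where
  K_Kinv := h.Kinv_K
  Kinv_K := h.K_Kinv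
  K_K := h.Kinv_Kinv
  K_E i j := by rw [mul_neg, neg_mul, smul_neg, h.Kinv_F]
  K_F i j := by rw [mul_neg, neg_mul, smul_neg, h.Kinv_E]
  E_F_same i := by rw [neg_mul_neg, neg_mul_neg, ← neg_sub, h.E_F_same, ← smul_neg, neg_sub]
  E_F_ne i j hij := by
    rw [neg_mul_neg, neg_mul_neg, ← neg_sub, h.E_F_ne j i hij.symm, neg_zero]
  serre_E i j hij := by
    have := serreSum_smul (D.qi i) (1 - D.a i j).toNat (-1) (-1) (f i) (f j)
    rw [h.serre_F i j hij] at this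
    simpa using this
  serre_F i j hij := by
    have := serreSum_smul (D.qi i) (1 - D.a i j).toNat (-1) (-1) (e i) (e j)
    rw [h.serre_E i j hij] at this
    simpa using this

lemma Realization.conjOp {B : Type*} [Ring B] [Algebra ℂ B] {e f k k' : I → Bᵐᵒᵖ}
    (h : Realization D e f k k') :
    Realization D (fun i => ConjOp.of (e i)) (fun i => ConjOp.of (f i))
      (fun i => ConjOp.of (k i)) (fun i => ConjOp.of (k' i)) := by
  have hq : ∀ i, starRingEnd ℂ (D.qi i) = D.qi i := D.conj_qi
  have hs : ∀ (i : I) (m : ℕ) (x z : Bᵐᵒᵖ), serreSum (D.qi i) m (ConjOp.of x) (ConjOp.of z) =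
      ConjOp.of (serreSum (D.qi i) m x z) := by
    intro i m x z
    simp only [serreSum, map_sum]
    refine Finset.sum_congr rfl fun j _ => ?_
    rw [← map_pow, ← map_pow, ← map_mul, ← map_mul, ConjOp.smul_of]
    simp [conj_qBinomial (D.conj_qi i)]
  constructor
  · intro i; rw [← map_mul, h.K_Kinv, map_one]
  · intro i; rw [← map_mul, h.Kinv_K, map_one]
  · intro i j; rw [← map_mul, ← map_mul, h.K_K]
  · intro i j; rw [← map_mul, ← map_mul, h.K_E, ConjOp.smul_of]; simp [hq]
  · intro i j; rw [← map_mul, ← map_mul, h.K_F, ConjOp.smul_of]; simp [hq]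
  · intro i
    rw [← map_mul, ← map_mul, ← map_sub, ← map_sub, h.E_F_same, ConjOp.smul_of]; simp [hq]
  · intro i j hij; rw [← map_mul, ← map_mul, ← map_sub, h.E_F_ne i j hij, map_zero]
  · intro i j hij; rw [hs, h.serre_E i j hij, map_zero]
  · intro i j hij; rw [hs, h.serre_F i j hij, map_zero]

lemma realization_star : Realization D
    (fun i => ConjOp.of (MulOpposite.op (K D i * F D i)))
    (fun i => ConjOp.of (MulOpposite.op (E D i * Kinv D i)))
    (fun i => ConjOp.of (MulOpposite.op (K D i)))
    (fun i => ConjOp.of (MulOpposite.op (Kinv D i))) := by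
  have := (realization_antipode (D := D)).chevalley.conjOp
  simpa using this

/-- The `*`-operation as a homomorphism into the conjugate opposite algebra. -/
def starHom : Uq D →ₐ[ℂ] ConjOp (Uq D) := lift realization_star

instance : Star (Uq D) := ⟨fun x => (ConjOp.of.symm (starHom x)).unop⟩

lemma star_def (x : Uq D) : star x = (ConjOp.of.symm (starHom x)).unop := rfl

lemma star_E (i : I) : star (E D i) = K D i * F D i := by simp [star_def, starHom]
lemma star_F (i : I) : star (F D i) = E D i * Kinv D i := by simp [star_def, starHom]
lemma star_K (i : I) : star (K D i) = K D i := by simp [star_def, starHom]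
lemma star_Kinv (i : I) : star (Kinv D i) = Kinv D i := by simp [star_def, starHom]
lemma star_algebraMap' (c : ℂ) :
    star (algebraMap ℂ (Uq D) c) = algebraMap ℂ (Uq D) (starRingEnd ℂ c) := by
  rw [star_def, AlgHom.commutes, ConjOp.algebraMap_eq]; simp
lemma star_mul' (x y : Uq D) : star (x * y) = star y * star x := by simp [star_def]
lemma star_add' (x y : Uq D) : star (x + y) = star x + star y := by simp [star_def]

instance : StarRing (Uq D) where
  star_mul := star_mul'
  star_add := star_add'
  star_involutive x := by
    have h := realization D
    induction x using induction with
    | hc c => simp [star_algebraMap']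
    | hE i => rw [star_E, star_mul', star_K, star_F, mul_assoc, h.Kinv_K, mul_one]
    | hF i => rw [star_F, star_mul', star_E, star_Kinv, ← mul_assoc, h.Kinv_K, one_mul]
    | hK i => rw [star_K, star_K]
    | hKinv i => rw [star_Kinv, star_Kinv]
    | hmul x y hx hy => rw [star_mul', star_mul', hx, hy]
    | hadd x y hx hy => rw [star_add', star_add', hx, hy]

instance : StarModule ℂ (Uq D) where
  star_smul c x := by
    rw [Algebra.smul_def, star_mul', star_algebraMap', ← Algebra.commutes, ← Algebra.smul_def]
    rfl

/-- `K_i` as a unit. -/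
def Kunit (D : QuantumCartanDatum I) (i : I) : (Uq D)ˣ where
  val := K D i
  inv := Kinv D i
  val_inv := (realization D).K_Kinv i
  inv_val := (realization D).Kinv_K i

/-- `K_1 ^ n_1 ⋯ K_r ^ n_r`. -/
def Kmonomial [Fintype I] (D : QuantumCartanDatum I) (n : I → ℤ) : (Uq D)ˣ :=
  Finset.univ.noncommProd (fun i => Kunit D i ^ n i) fun i _ j _ _ =>
    Commute.zpow_zpow (Units.ext ((realization D).K_K i j)) _ _

end Uq

/-! ### The quantized coordinate ring -/

/-- The linear dual of `U_q(𝔤)`, with the multiplication `(φ ψ)(X) = (φ ⊗ ψ)(Δ X)`. -/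
abbrev UqDual (D : QuantumCartanDatum I) : Type _ := WithConv (Uq D →ₗ[ℂ] ℂ)

section rep

variable {N M : Type*} [Fintype N] [DecidableEq N] [Fintype M] [DecidableEq M]

/-- The matrix coefficient `X ↦ π(X)^i_j`. -/
def matrixCoeff (π : Uq D →ₐ[ℂ] Matrix N N ℂ) (i j : N) : UqDual D :=
  WithConv.toConv (Matrix.entryLinearMap ℂ ℂ i j ∘ₗ π.toLinearMap)

@[simp] lemma matrixCoeff_apply (π : Uq D →ₐ[ℂ] Matrix N N ℂ) (i j : N) (X : Uq D) :
    matrixCoeff π i j X = π X i j := rfl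

/-- A finite-dimensional representation is of type one if it is spanned by joint eigenvectors of the
`K_i` with eigenvalues in `q_i ^ ℤ`. -/
def IsTypeOne (π : Uq D →ₐ[ℂ] Matrix N N ℂ) : Prop :=
  Submodule.span ℂ {w : N → ℂ | ∀ i, ∃ k : ℤ,
    (π (Uq.K D i)).mulVec w = D.qi i ^ k • w} = ⊤

/-- The tensor product of two representations. -/
def tensorRep (π : Uq D →ₐ[ℂ] Matrix N N ℂ) (π' : Uq D →ₐ[ℂ] Matrix M M ℂ) :
    Uq D →ₐ[ℂ] Matrix (N × M) (N × M) ℂ :=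
  ((Matrix.kroneckerAlgEquiv N M ℂ).toAlgHom.comp (Algebra.TensorProduct.map π π')).comp
    Uq.comulHom

/-- The conjugate representation `X ↦ conj(π(S(X)^*))`. -/
def conjRep (π : Uq D →ₐ[ℂ] Matrix N N ℂ) : Uq D →ₐ[ℂ] Matrix N N ℂ where
  toFun X := (π (star (Uq.antipode X))).map (starRingEnd ℂ)
  map_one' := by simp [Uq.antipode_one]
  map_mul' X Y := by simp [Uq.antipode_mul]
  map_zero' := by simp
  map_add' X Y := by ext; simp
  commutes' c := by
    rw [Uq.antipode_algebraMap, Uq.star_algebraMap', AlgHom.commutes]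
    ext i j
    by_cases h : i = j <;> simp [Matrix.algebraMap_matrix_apply, h]

lemma matrixCoeff_mul (π : Uq D →ₐ[ℂ] Matrix N N ℂ) (π' : Uq D →ₐ[ℂ] Matrix M M ℂ)
    (i j : N) (i' j' : M) :
    matrixCoeff π i j * matrixCoeff π' i' j' = matrixCoeff (tensorRep π π') (i, i') (j, j') := by
  ext X
  change LinearMap.mul' ℂ ℂ (TensorProduct.map _ _ (Uq.comulHom X)) =
    Matrix.kroneckerAlgEquiv N M ℂ (Algebra.TensorProduct.map π π' (Uq.comulHom X)) (i, i') (j, j')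
  generalize Uq.comulHom X = t
  induction t with
  | zero => simp
  | add a b ha hb => rw [map_add, map_add, ha, hb, map_add, map_add]; rfl
  | tmul a b => simp [matrixCoeff, Matrix.kroneckerAlgEquiv]

lemma IsTypeOne.tensor {π : Uq D →ₐ[ℂ] Matrix N N ℂ} {π' : Uq D →ₐ[ℂ] Matrix M M ℂ}
    (h : IsTypeOne π) (h' : IsTypeOne π') : IsTypeOne (tensorRep π π') := by
  let β : (N → ℂ) →ₗ[ℂ] (M → ℂ) →ₗ[ℂ] (N × M → ℂ) :=
    LinearMap.mk₂ ℂ (fun w w' x => w x.1 * w' x.2)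
      (by intros; ext; simp [add_mul]) (by intros; ext; simp [mul_assoc])
      (by intros; ext; simp [mul_add]) (by intros; ext; simp [mul_left_comm])
  have htop : Submodule.map₂ β ⊤ ⊤ = ⊤ := by
    rw [eq_top_iff, ← (Pi.basisFun ℂ (N × M)).span_eq, Submodule.span_le]
    rintro _ ⟨⟨a, b⟩, rfl⟩
    have : Pi.basisFun ℂ (N × M) (a, b) = β (Pi.single a 1) (Pi.single b 1) := by
      ext ⟨c, d⟩
      by_cases hc : c = a <;> by_cases hd : d = b <;> simp [β, hc, hd]
    rw [this]
    exact Submodule.apply_mem_map₂ _ trivial trivial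
  rw [IsTypeOne, eq_top_iff, ← htop, ← h, ← h', Submodule.map₂_span_span, Submodule.span_le]
  rintro _ ⟨w, hw, w', hw', rfl⟩
  refine Submodule.subset_span fun i => ?_
  obtain ⟨k, hk⟩ := hw i
  obtain ⟨k', hk'⟩ := hw' i
  refine ⟨k + k', ?_⟩
  have hK : tensorRep π π' (Uq.K D i) = Matrix.kronecker (π (Uq.K D i)) (π' (Uq.K D i)) := by
    ext
    simp [tensorRep, Uq.comulHom, Matrix.kroneckerAlgEquiv]
  rw [hK, zpow_add₀ (D.qi_ne_zero i)]
  ext ⟨a, b⟩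
  have e1 := congrFun hk a
  have e2 := congrFun hk' b
  simp only [Matrix.mulVec, dotProduct, Pi.smul_apply, smul_eq_mul] at e1 e2 ⊢
  rw [Fintype.sum_prod_type]
  simp only [β, LinearMap.mk₂_apply, Matrix.kronecker, Matrix.kroneckerMap_apply]
  rw [show D.qi i ^ k * D.qi i ^ k' * (w a * w' b) = (D.qi i ^ k * w a) * (D.qi i ^ k' * w' b) by
    ring, ← e1, ← e2, Finset.sum_mul_sum]
  exact Finset.sum_congr rfl fun _ _ => Finset.sum_congr rfl fun _ _ => by ring

lemma IsTypeOne.conj {π : Uq D →ₐ[ℂ] Matrix N N ℂ} (h : IsTypeOne π) : IsTypeOne (conjRep π) := by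
  let σ : (N → ℂ) →ₛₗ[starRingEnd ℂ] (N → ℂ) :=
    { toFun := fun w x => starRingEnd ℂ (w x)
      map_add' := by intros; ext; simp
      map_smul' := by intros; ext; simp }
  have hσ : Function.Surjective σ := fun w => ⟨fun x => starRingEnd ℂ (w x), by ext; simp [σ]⟩
  rw [IsTypeOne, eq_top_iff, ← LinearMap.range_eq_top.2 hσ, LinearMap.range_eq_map, ← h,
    Submodule.map_span, Submodule.span_le]
  rintro _ ⟨w, hw, rfl⟩
  refine Submodule.subset_span fun i => ?_
  obtain ⟨k, hk⟩ := hw i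
  refine ⟨-k, ?_⟩
  have hinv : (π (Uq.Kinv D i)).mulVec w = D.qi i ^ (-k) • w := by
    have h1 : (π (Uq.Kinv D i)).mulVec ((π (Uq.K D i)).mulVec w) = w := by
      rw [Matrix.mulVec_mulVec, ← map_mul, (Uq.realization D).Kinv_K, map_one, Matrix.one_mulVec]
    rw [hk, Matrix.mulVec_smul] at h1
    rw [zpow_neg, eq_inv_smul_iff₀ (zpow_ne_zero _ (D.qi_ne_zero i)), h1]
  have hK : conjRep π (Uq.K D i) = (π (Uq.Kinv D i)).map (starRingEnd ℂ) := by
    change (π (star (Uq.antipode (Uq.K D i)))).map _ = _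
    rw [Uq.antipode_K, Uq.star_Kinv]
  have hq : starRingEnd ℂ (D.qi i) = D.qi i := D.conj_qi i
  rw [hK]
  ext a
  have := congrArg (starRingEnd ℂ) (congrFun hinv a)
  simpa [Matrix.mulVec, dotProduct, σ, hq, map_sum] using this

end rep

/-- The span of the matrix coefficients of finite-dimensional (type one) representations. -/
def coordSpan (D : QuantumCartanDatum I) : Submodule ℂ (UqDual D) :=
  Submodule.span ℂ {φ | ∃ (N : Type) (_ : Fintype N) (_ : DecidableEq N)
    (π : Uq D →ₐ[ℂ] Matrix N N ℂ) (i j : N), IsTypeOne π ∧ φ = matrixCoeff π i j}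

lemma matrixCoeff_mem {N : Type} [Fintype N] [DecidableEq N] {π : Uq D →ₐ[ℂ] Matrix N N ℂ}
    (hπ : IsTypeOne π) (i j : N) : matrixCoeff π i j ∈ coordSpan D :=
  Submodule.subset_span ⟨N, _, _, π, i, j, hπ, rfl⟩

lemma one_mem_coordSpan : (1 : UqDual D) ∈ coordSpan D := by
  let π : Uq D →ₐ[ℂ] Matrix Unit Unit ℂ := (Algebra.ofId ℂ _).comp Uq.counitHom
  have h1 : (1 : UqDual D) = matrixCoeff π () () := by
    ext X
    change Uq.counitHom X = algebraMap ℂ (Matrix Unit Unit ℂ) (Uq.counitHom X) () ()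
    simp [Matrix.algebraMap_matrix_apply]
  rw [h1]
  refine matrixCoeff_mem ?_ _ _
  rw [IsTypeOne, eq_top_iff]
  intro w _
  refine Submodule.subset_span fun i => ⟨0, ?_⟩
  simp [π, Uq.counitHom]

lemma mul_mem_coordSpan {φ ψ : UqDual D} (hφ : φ ∈ coordSpan D) (hψ : ψ ∈ coordSpan D) :
    φ * ψ ∈ coordSpan D := by
  have : coordSpan D * coordSpan D ≤ coordSpan D := by
    rw [coordSpan, Submodule.span_mul_span, Submodule.span_le]
    rintro _ ⟨_, ⟨N, _, _, π, i, j, hπ, rfl⟩, _, ⟨M, _, _, π', i', j', hπ', rfl⟩, rfl⟩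
    simp only [matrixCoeff_mul]
    exact matrixCoeff_mem (hπ.tensor hπ') _ _
  exact this (Submodule.mul_mem_mul hφ hψ)

/-- The quantized coordinate ring `ℂ_q[G]`. -/
def Cq (D : QuantumCartanDatum I) : Subalgebra ℂ (UqDual D) :=
  (coordSpan D).toSubalgebra one_mem_coordSpan fun _ _ => mul_mem_coordSpan

lemma mem_Cq {φ : UqDual D} : φ ∈ Cq D ↔ φ ∈ coordSpan D := Iff.rfl

/-- `φ^*(X) = conj(φ(S(X)^*))`. -/
def dualStar (φ : UqDual D) : UqDual D :=
  WithConv.toConv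
    { toFun := fun X => starRingEnd ℂ (φ (star (Uq.antipode X)))
      map_add' := by intros; simp
      map_smul' := by intros; simp [star_smul] }

@[simp] lemma dualStar_apply (φ : UqDual D) (X : Uq D) :
    dualStar φ X = starRingEnd ℂ (φ (star (Uq.antipode X))) := rfl

/-- `(X ▷ φ)(Y) = φ(Y X)`. -/
def leftAct (X : Uq D) : UqDual D →ₗ[ℂ] UqDual D where
  toFun φ := WithConv.toConv (φ.ofConv ∘ₗ LinearMap.mulRight ℂ X)
  map_add' _ _ := rfl
  map_smul' _ _ := rfl

@[simp] lemma leftAct_apply (X : Uq D) (φ : UqDual D) (Y : Uq D) :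
    leftAct X φ Y = φ (Y * X) := rfl

lemma dualStar_mem {φ : UqDual D} (hφ : φ ∈ Cq D) : dualStar φ ∈ Cq D := by
  rw [mem_Cq] at *
  induction hφ using Submodule.span_induction with
  | mem φ h =>
    obtain ⟨N, _, _, π, i, j, hπ, rfl⟩ := h
    have : dualStar (matrixCoeff π i j) = matrixCoeff (conjRep π) i j := rfl
    rw [this]
    exact matrixCoeff_mem hπ.conj i j
  | zero =>
    have : dualStar (0 : UqDual D) = 0 := by ext; simp
    rw [this]; exact zero_mem _
  | add φ ψ _ _ h h' =>
    have : dualStar (φ + ψ) = dualStar φ + dualStar ψ := by ext; simp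
    rw [this]; exact add_mem h h'
  | smul c φ _ h =>
    have : dualStar (c • φ) = starRingEnd ℂ c • dualStar φ := by ext; simp
    rw [this]; exact Submodule.smul_mem _ _ h

lemma leftAct_mem (X : Uq D) {φ : UqDual D} (hφ : φ ∈ Cq D) : leftAct X φ ∈ Cq D := by
  rw [mem_Cq] at *
  induction hφ using Submodule.span_induction with
  | mem φ h =>
    obtain ⟨N, _, _, π, i, j, hπ, rfl⟩ := h
    have : leftAct X (matrixCoeff π i j) = ∑ k, π X k j • matrixCoeff π i k := by
      ext Y; simp [Matrix.mul_apply, mul_comm]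
    rw [this]
    exact Submodule.sum_mem _ fun k _ => Submodule.smul_mem _ _ (matrixCoeff_mem hπ i k)
  | zero => rw [map_zero]; exact zero_mem _
  | add φ ψ _ _ h h' => rw [map_add]; exact add_mem h h'
  | smul c φ _ h => rw [map_smul]; exact Submodule.smul_mem _ _ h

namespace Cq

instance : Star (Cq D) := ⟨fun φ => ⟨dualStar φ, dualStar_mem φ.2⟩⟩

/-- The left action `X ▷ φ` on `ℂ_q[G]`. -/
def act (X : Uq D) : Cq D →ₗ[ℂ] Cq D :=
  (leftAct X ∘ₗ (Cq D).val.toLinearMap).codRestrict (Subalgebra.toSubmodule (Cq D))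
    fun φ => leftAct_mem X φ.2

/-- The counit `ε(φ) = φ(1)`. -/
def counit : Cq D →ₗ[ℂ] ℂ where
  toFun φ := (φ : UqDual D) 1
  map_add' _ _ := rfl
  map_smul' _ _ := rfl

end Cq

/-- The functional `a₀ ⊗ a₁ ⊗ a₂ ↦ ε(a₀) ε(X ▷ a₁) ε(Y ▷ a₂)`. -/
def etaXY (X Y : Uq D) : Cq D ⊗[ℂ] Cq D ⊗[ℂ] Cq D →ₗ[ℂ] ℂ :=
  LinearMap.mul' ℂ ℂ ∘ₗ TensorProduct.map
    (LinearMap.mul' ℂ ℂ ∘ₗ TensorProduct.map Cq.counit (Cq.counit ∘ₗ Cq.act X))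
    (Cq.counit ∘ₗ Cq.act Y)

lemma etaXY_tmul (X Y : Uq D) (x y z : Cq D) :
    etaXY X Y (x ⊗ₜ[ℂ] y ⊗ₜ[ℂ] z) =
      Cq.counit x * Cq.counit (Cq.act X y) * Cq.counit (Cq.act Y z) := by
  simp [etaXY]

/-- `η_a = η_{F_a, E_a}`. -/
def eta (i : I) : Cq D ⊗[ℂ] Cq D ⊗[ℂ] Cq D →ₗ[ℂ] ℂ := etaXY (Uq.F D i) (Uq.E D i)

/-- `Tr(V (2 P - Id) ⊗ P ⊗ P)`. -/
def twoChain {A : Type*} [Ring A] [Algebra ℂ A] {N : Type*} [Fintype N] [DecidableEq N]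
    (V : Matrix N N ℂ) (P : Matrix N N A) : A ⊗[ℂ] A ⊗[ℂ] A :=
  ∑ i, ∑ j, ∑ k, ∑ l, V i j • ((2 • P - 1 : Matrix N N A) j k ⊗ₜ[ℂ] P k l ⊗ₜ[ℂ] P l i)

end coordinateRing

/-! ### The quantized enveloping algebra of a complex simple Lie algebra -/

section lie

open LieAlgebra LieAlgebra.IsKilling

variable {𝔤 : Type*} [LieRing 𝔤] [LieAlgebra ℂ 𝔤] [FiniteDimensional ℂ 𝔤] [LieAlgebra.IsSimple ℂ 𝔤]
variable (H : LieSubalgebra ℂ 𝔤) [H.IsCartanSubalgebra]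

/-- The bilinear form on `𝔥^*` induced by the Killing form: `(λ, μ) = κ(t_λ, t_μ)` where
`κ(t_λ, x) = λ(x)` for `x ∈ 𝔥`. -/
def killingDual : LinearMap.BilinForm ℂ (Module.Dual ℂ H) :=
  ((killingForm ℂ 𝔤).restrict H).compl₁₂ (cartanEquivDual H).symm.toLinearMap
    (cartanEquivDual H).symm.toLinearMap

/-- The smallest square length of a root with respect to `killingDual`. -/
def minSqLength : ℝ :=
  ⨅ α : H.root, (killingDual H ((rootSystem H).root α) ((rootSystem H).root α)).re

/-- The bilinear form `(·, ·)` on `𝔥^*`: the multiple of `killingDual` for which the short roots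
have square length `2`. -/
def form : LinearMap.BilinForm ℂ (Module.Dual ℂ H) :=
  ((2 / minSqLength H : ℝ) : ℂ) • killingDual H

lemma killingDual_apply (lam μ : Module.Dual ℂ H) :
    killingDual H lam μ = lam ((cartanEquivDual H).symm μ) := by
  have : cartanEquivDual H ((cartanEquivDual H).symm lam) ((cartanEquivDual H).symm μ) =
      lam ((cartanEquivDual H).symm μ) := by rw [LinearEquiv.apply_symm_apply]
  rw [← this]
  rfl

lemma killingDual_symm (lam μ : Module.Dual ℂ H) : killingDual H lam μ = killingDual H μ lam :=
  LieModule.traceForm_comm ℂ 𝔤 𝔤 _ _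

lemma form_symm (lam μ : Module.Dual ℂ H) : form H lam μ = form H μ lam := by
  simp [form, killingDual_symm H lam μ]

lemma coroot_mul_killingDual (α : H.root) (lam : Module.Dual ℂ H) :
    lam ((rootSystem H).coroot α) *
        killingDual H ((rootSystem H).root α) ((rootSystem H).root α) =
      2 * killingDual H ((rootSystem H).root α) lam := by
  have h2 := root_apply_cartanEquivDual_symm_ne_zero (LieSubalgebra.isNonZero_coe_root α)
  rw [killingDual_symm H _ lam, killingDual_apply, killingDual_apply, rootSystem_coroot_apply,
    coroot]
  simp only [rootSystem_root_apply, LieModule.Weight.toLinear_apply]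
  rw [map_nsmul, map_smul]
  simp only [smul_eq_mul, nsmul_eq_mul]
  field_simp
  push_cast
  ring

lemma pairing_mul_killingDual (α β : H.root) :
    ((rootSystem H).pairingIn ℤ β α : ℂ) *
        killingDual H ((rootSystem H).root α) ((rootSystem H).root α) =
      2 * killingDual H ((rootSystem H).root α) ((rootSystem H).root β) := by
  have h1 : ((rootSystem H).pairingIn ℤ β α : ℂ) = (rootSystem H).pairing β α := by
    simpa using (rootSystem H).algebraMap_pairingIn ℤ β α
  rw [h1, ← coroot_mul_killingDual]
  rfl

lemma killingDual_root (α : H.root) : ∃ s : ℝ, 0 < s ∧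
    killingDual H ((rootSystem H).root α) ((rootSystem H).root α) = (s : ℂ) := by
  set s := killingDual H ((rootSystem H).root α) ((rootSystem H).root α) with hs
  have hs0 : s ≠ 0 := by
    rw [hs, killingDual_apply]
    exact root_apply_cartanEquivDual_symm_ne_zero (LieSubalgebra.isNonZero_coe_root α)
  have key : s * 4 = s ^ 2 * ((∑ β : H.root, ((rootSystem H).pairingIn ℤ β α) ^ 2 : ℤ) : ℂ) := by
    have h1 : s = ∑ β : H.root, killingDual H ((rootSystem H).root α) ((rootSystem H).root β) ^ 2 := by
      have := congrArg (fun B : LinearMap.BilinForm ℂ H => B ((cartanEquivDual H).symm ((rootSystem H).root α))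
        ((cartanEquivDual H).symm ((rootSystem H).root α))) (restrict_killingForm_eq_sum (K := ℂ) (L := 𝔤) (H := H))
      rw [← Finset.sum_coe_sort] at this
      simp only [LinearMap.sum_apply, LinearMap.smulRight_apply, LinearMap.smul_apply] at this
      refine this.trans (Finset.sum_congr rfl fun β _ => ?_)
      rw [killingDual_symm H _ ((rootSystem H).root β), killingDual_apply, sq]
      rfl
    conv_lhs => rw [h1]
    rw [Finset.sum_mul]
    push_cast
    rw [Finset.mul_sum]
    refine Finset.sum_congr rfl fun β _ => ?_
    have := pairing_mul_killingDual H α β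
    rw [← hs] at this
    linear_combination (-(((rootSystem H).pairingIn ℤ β α : ℂ) * s +
      2 * killingDual H ((rootSystem H).root α) ((rootSystem H).root β))) * this
  have hn : 0 ≤ ∑ β : H.root, ((rootSystem H).pairingIn ℤ β α) ^ 2 :=
    Finset.sum_nonneg fun _ _ => sq_nonneg _
  set n := ∑ β : H.root, ((rootSystem H).pairingIn ℤ β α) ^ 2
  have e : (4 : ℂ) = s * (n : ℂ) := by
    apply mul_left_cancel₀ hs0
    rw [key]; ring
  have hn0 : n ≠ 0 := by
    intro h
    rw [h] at e
    simp at e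
  have hpos : 0 < n := lt_of_le_of_ne hn (Ne.symm hn0)
  refine ⟨4 / n, by positivity, ?_⟩
  push_cast
  rw [eq_div_iff (by exact_mod_cast hn0), e]

lemma minSqLength_pos (α : H.root) : 0 < minSqLength H := by
  have : Nonempty H.root := ⟨α⟩
  obtain ⟨β, hβ⟩ := exists_eq_ciInf_of_finite
    (f := fun α : H.root => (killingDual H ((rootSystem H).root α) ((rootSystem H).root α)).re)
  obtain ⟨s, hs, hs'⟩ := killingDual_root H β
  have e : s = minSqLength H := by
    rw [minSqLength, ← hβ, hs']; simp
  rwa [← e]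

lemma form_root (α : H.root) : ∃ s : ℝ, 0 < s ∧
    form H ((rootSystem H).root α) ((rootSystem H).root α) = (s : ℂ) := by
  obtain ⟨s, hs, hs'⟩ := killingDual_root H α
  refine ⟨2 / minSqLength H * s, mul_pos (div_pos two_pos (minSqLength_pos H α)) hs, ?_⟩
  simp only [form, LinearMap.smul_apply, smul_eq_mul, hs', Complex.ofReal_mul]

lemma coroot_mul_form (α : H.root) (lam : Module.Dual ℂ H) :
    lam ((rootSystem H).coroot α) *
        form H ((rootSystem H).root α) ((rootSystem H).root α) =
      2 * form H ((rootSystem H).root α) lam := by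
  simp only [form, LinearMap.smul_apply, smul_eq_mul]
  linear_combination (((2 / minSqLength H : ℝ) : ℂ)) * coroot_mul_killingDual H α lam

lemma pairing_mul_form (α β : H.root) :
    ((rootSystem H).pairingIn ℤ β α : ℂ) *
        form H ((rootSystem H).root α) ((rootSystem H).root α) =
      2 * form H ((rootSystem H).root α) ((rootSystem H).root β) := by
  simp only [form, LinearMap.smul_apply, smul_eq_mul]
  linear_combination (((2 / minSqLength H : ℝ) : ℂ)) * pairing_mul_killingDual H α β

variable {H}
variable (b : (rootSystem H).Base)

/-- The simple root `α_i`. -/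
def simpleRoot (i : b.support) : Module.Dual ℂ H := (rootSystem H).root i

/-- `d_i = (α_i, α_i) / 2`. -/
def dSym (i : b.support) : ℂ := form H (simpleRoot b i) (simpleRoot b i) / 2

/-- The Cartan matrix `a_ij = ⟨α_j, α_i^∨⟩ = 2 (α_i, α_j) / (α_i, α_i)`. -/
def cartanInt (i j : b.support) : ℤ := (rootSystem H).pairingIn ℤ j i

lemma form_simpleRoot (i j : b.support) :
    form H (simpleRoot b i) (simpleRoot b j) = dSym b i * cartanInt b i j := by
  have := pairing_mul_form H (i : H.root) (j : H.root)
  simp only [dSym, cartanInt, simpleRoot]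
  linear_combination (-1 / 2 : ℂ) * this

/-- The Cartan datum of `𝔤` with `q_i = q ^ d_i`. -/
def datum (q : ℝ) (hq0 : 0 < q) (hq1 : q ≠ 1) : QuantumCartanDatum b.support where
  a := cartanInt b
  qi i := (q : ℂ) ^ dSym b i
  a_self i := by simp [cartanInt]
  a_nonpos i j hij := b.pairingIn_le_zero_of_ne (fun h => hij (Subtype.ext h.symm)) j.2 i.2
  symm i j := by
    rw [← Complex.cpow_mul_int, ← Complex.cpow_mul_int, ← form_simpleRoot, ← form_simpleRoot,
      form_symm]
  conj_qi i := by
    obtain ⟨s, -, hs⟩ := form_root H (i : H.root)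
    have : dSym b i = ((s / 2 : ℝ) : ℂ) := by
      rw [dSym, simpleRoot, hs]; push_cast; rfl
    rw [this, ← Complex.ofReal_cpow hq0.le]
    exact Complex.conj_ofReal _
  qi_ne_zero i := by
    rw [Complex.cpow_def_of_ne_zero (by exact_mod_cast hq0.ne')]
    exact Complex.exp_ne_zero _
  qi_pow_ne_one i n hn := by
    obtain ⟨s, hs0, hs⟩ := form_root H (i : H.root)
    have : dSym b i = ((s / 2 : ℝ) : ℂ) := by
      rw [dSym, simpleRoot, hs]; push_cast; rfl
    rw [this, ← Complex.ofReal_cpow hq0.le, ← Complex.ofReal_pow, ← Real.rpow_natCast,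
      ← Real.rpow_mul hq0.le]
    norm_cast
    intro h
    have hx : s / 2 * n ≠ 0 := by positivity
    rw [← Real.rpow_zero q, Real.rpow_right_inj hq0 hq1] at h
    exact hx h

/-- Half the sum of the positive roots. -/
def rho : Module.Dual ℂ H :=
  open scoped Classical in
  (1 / 2 : ℂ) • ∑ α ∈ Finset.univ.filter (fun α : H.root => b.IsPos α), (rootSystem H).root α

/-- The element `2ρ` of the root lattice. -/
def twoRho : (rootSystem H).rootSpan ℤ :=
  open scoped Classical in
  ∑ α ∈ Finset.univ.filter (fun α : H.root => b.IsPos α), (rootSystem H).rootSpanMem ℤ α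

lemma coe_twoRho : (twoRho b : Module.Dual ℂ H) = (2 : ℂ) • rho b := by
  simp [twoRho, rho, smul_smul]

/-- A weight is integral if it takes integer values on all coroots. -/
def IsIntegralWeight (lam : Module.Dual ℂ H) : Prop :=
  ∀ α : H.root, ∃ n : ℤ, lam ((rootSystem H).coroot α) = n

variable (q : ℝ) (hq0 : 0 < q) (hq1 : q ≠ 1)

/-- `K_λ = K_1 ^ n_1 ⋯ K_r ^ n_r` for `λ = n_1 α_1 + ⋯ + n_r α_r` in the root lattice. -/
def Klam (lam : (rootSystem H).rootSpan ℤ) : (Uq (datum b q hq0 hq1))ˣ :=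
  Uq.Kmonomial _ (b.toWeightBasisInt.repr lam)

variable {b q hq0 hq1}
variable {V : Type*} [NormedAddCommGroup V] [InnerProductSpace ℂ V]

/-- `v` is a vector of weight `λ`. -/
def IsWeightVector (π : Uq (datum b q hq0 hq1) →ₐ[ℂ] Module.End ℂ V) (lam : Module.Dual ℂ H)
    (v : V) : Prop :=
  ∀ i : b.support, π (Uq.K _ i) v = ((q : ℂ) ^ form H (simpleRoot b i) lam) • v

/-- `V` is the irreducible representation `V(Λ)` of highest weight `Λ`, a dominant integral
weight. -/
structure IsIrrepOfHighestWeight (π : Uq (datum b q hq0 hq1) →ₐ[ℂ] Module.End ℂ V)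
    (Lam : Module.Dual ℂ H) : Prop where
  dominant : ∀ i : b.support, ∃ n : ℕ, Lam ((rootSystem H).coroot i) = n
  irreducible : ∀ W : Submodule ℂ V, (∀ X, ∀ w ∈ W, π X w ∈ W) → W = ⊥ ∨ W = ⊤
  exists_highest : ∃ v : V, v ≠ 0 ∧ (∀ i, π (Uq.E _ i) v = 0) ∧ IsWeightVector π Lam v

/-- The inner product of `V` is invariant: `⟨X v, w⟩ = ⟨v, X^* w⟩`. -/
def IsUnitaryRep (π : Uq (datum b q hq0 hq1) →ₐ[ℂ] Module.End ℂ V) : Prop :=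
  ∀ X v w, inner ℂ (π X v) w = inner ℂ v (π (star X) w)

/-- An orthonormal basis `v_i` of `V` consisting of vectors of (integral) weights `λ_i`. -/
structure WeightBasis (π : Uq (datum b q hq0 hq1) →ₐ[ℂ] Module.End ℂ V) (N : ℕ) where
  /-- the basis `v_i` -/
  vec : OrthonormalBasis (Fin N) ℂ V
  /-- the weights `λ_i` -/
  wt : Fin N → Module.Dual ℂ H
  integral : ∀ i, IsIntegralWeight (wt i)
  isWeightVector : ∀ i, IsWeightVector π (wt i) (vec i)

namespace WeightBasis

variable {π : Uq (datum b q hq0 hq1) →ₐ[ℂ] Module.End ℂ V} {N : ℕ} (B : WeightBasis π N)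

/-- The matrices `π(X)^i_j`, where `X ▷ v_j = ∑ᵢ π(X)^i_j v_i`. -/
def mat : Uq (datum b q hq0 hq1) →ₐ[ℂ] Matrix (Fin N) (Fin N) ℂ :=
  (LinearMap.toMatrixAlgEquiv B.vec.toBasis).toAlgHom.comp π

lemma mat_K (i : b.support) (j : Fin N) :
    (B.mat (Uq.K _ i)).mulVec (Pi.single j 1) =
      ((q : ℂ) ^ form H (simpleRoot b i) (B.wt j)) • Pi.single j 1 := by
  ext k
  have h := B.isWeightVector j i
  simp only [mat, AlgHom.comp_apply, Matrix.mulVec_single_one]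
  change LinearMap.toMatrixAlgEquiv B.vec.toBasis (π (Uq.K _ i)) k j = _
  rw [LinearMap.toMatrixAlgEquiv_apply]
  simp only [OrthonormalBasis.coe_toBasis, h, map_smul, OrthonormalBasis.coe_toBasis_repr_apply,
    Finsupp.smul_apply, Pi.smul_apply]
  simp [Pi.single_apply]

lemma isTypeOne : IsTypeOne B.mat := by
  rw [IsTypeOne, eq_top_iff, ← (Pi.basisFun ℂ (Fin N)).span_eq, Submodule.span_le]
  rintro _ ⟨j, rfl⟩
  refine Submodule.subset_span fun i => ?_
  obtain ⟨k, hk⟩ := B.integral j i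
  refine ⟨k, ?_⟩
  rw [Pi.basisFun_apply, B.mat_K]
  congr 1
  change _ = ((q : ℂ) ^ dSym b i) ^ k
  rw [← Complex.cpow_mul_int]
  congr 1
  have h := coroot_mul_form H (i : H.root) (B.wt j)
  rw [hk] at h
  simp only [dSym, simpleRoot]
  linear_combination (-1 / 2 : ℂ) * h

/-- The matrix coefficients `u^i_j` as elements of `ℂ_q[G]`. -/
def u (i j : Fin N) : Cq (datum b q hq0 hq1) := ⟨matrixCoeff B.mat i j, matrixCoeff_mem B.isTypeOne i j⟩

/-- The matrix unit `M^n_m`, with entries `(M^n_m)^i_j = (u^m_i)^* u^n_j`. -/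
def matrixUnit (n m : Fin N) : Matrix (Fin N) (Fin N) (Cq (datum b q hq0 hq1)) :=
  Matrix.of fun i j => star (B.u m i) * B.u n j

/-- `P = ∑ c^m_n M^n_m`. -/
def projP (c : Matrix (Fin N) (Fin N) ℂ) : Matrix (Fin N) (Fin N) (Cq (datum b q hq0 hq1)) :=
  ∑ m, ∑ n, c m n • B.matrixUnit n m

/-- `C(P) = Tr(π(K_{2ρ}⁻¹) (2 P - Id) ⊗ P ⊗ P)`. -/
def cycle (P : Matrix (Fin N) (Fin N) (Cq (datum b q hq0 hq1))) :
    Cq (datum b q hq0 hq1) ⊗[ℂ] Cq (datum b q hq0 hq1) ⊗[ℂ] Cq (datum b q hq0 hq1) :=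
  twoChain (B.mat ↑(Klam b q hq0 hq1 (twoRho b))⁻¹) P

end WeightBasis

end lie

end QuantumFlag

end

open QuantumFlag

/-! Applying the functional `eta a` to the twisted chain replaces the three tensor factors by scalar
matrices: since `ε(X ▷ φ) = φ(X)`, the factors become the values of `2P - Id`, `P` and `P` at `1`,
`F_a` and `E_a`, and the chain becomes an ordinary trace (`etaXY_twoChain`). Unitarity gives
`(u^m_i)^*(X) = π(S(X))^i_m`, so the value of `P` at `X` is `∑ π(S(X₁)) c π(X₂)` in Sweedler
notation. This yields `P(1) = c`, and, writing `K`, `E`, `F` for the matrices of `K_a`, `E_a`,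
`F_a`, also `P(F_a) = K (cF - Fc)` and `P(E_a) = cE - E K⁻¹ c K`. As `c` preserves weight spaces it
commutes with `K`, and the last value is the commutator `cE - Ec`.

Moving `K` past `2c - 1` and joining it to `K_{2ρ}⁻¹`, the pairing becomes the trace of `T (2c -
1)(cF - Fc)(cE - Ec)` with `T = K_{α_a - 2ρ}`. Three facts now reduce this to the trace of `c T (EF
- FE)`, by `trace_twoChain_eq`. The matrix `c` is idempotent, because the counit is an algebra
homomorphism and sends `P` to `c`. It commutes with `T`. Finally `T` commutes with `E`, because
`(2ρ, α_a) = (α_a, α_a)` (`form_two_rho`); this is why the twist by `K_{2ρ}⁻¹` is the right one.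

The relation for `EF - FE` makes it diagonal, with entries the `q_a`-numbers of `(α_a, λ_i)/d_a`.
Since `T` is diagonal too, with entries `q^(α_a - 2ρ, λ_i)`, only the diagonal of `c` contributes
and the formula can be read off. -/

noncomputable section

namespace QuantumFlag

/-! ### A trace identity for an idempotent and two commutators. -/

section matrix

variable {n : Type*} [Fintype n] [DecidableEq n]

/-- The trace identity behind the evaluation of the twisted two-cycle. -/
lemma trace_twoChain_eq {c T E F : Matrix n n ℂ} (hc : c * c = c) (hT : T * c = c * T)
    (hE : T * E = E * T) :
    (T * ((2 * c - 1) * (c * F - F * c) * (c * E - E * c))).trace =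
      (c * T * (E * F - F * E)).trace := by
  -- The factor `2c - 1` is a grading: it turns `cF - Fc` into the off-diagonal part `cF(1 - c) + (1
  -- - c)Fc`. The full product is therefore `-cF(1 - c)Ec + (1 - c)FcE(1 - c)`, expanded here.
  have hX : (2 * c - 1) * (c * F - F * c) * (c * E - E * c) =
      -(c * F * c * E) - c * F * E * c + (c * F * c * E * c + c * F * c * E * c) + F * c * E
        - F * c * E * c := by
    have h : (2 * c - 1) * (c * F - F * c) = c * F - (c * F * c + c * F * c) + F * c := by
      have : (2 * c - 1) * (c * F - F * c) =
          (c * c) * F + (c * c) * F - (c * F * c + c * F * c) - c * F + F * c := by noncomm_ring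
      rw [this, hc]; abel
    rw [h]
    have : (c * F - (c * F * c + c * F * c) + F * c) * (c * E - E * c) =
        c * F * c * E - c * F * E * c - (c * F * (c * c) * E + c * F * (c * c) * E) +
          (c * F * c * E * c + c * F * c * E * c) + F * (c * c) * E - F * c * E * c := by
      noncomm_ring
    rw [this, hc]; abel
  -- In this and the next two traces the trailing `c` goes round cyclically and past `T` to stand in
  -- front of `F`, where it is absorbed if a `c` is already there. All terms with two separated
  -- factors `c` then cancel.
  have h1 : (T * (c * F * c * E * c)).trace = (T * (c * F * c * E)).trace := by
    rw [← mul_assoc, Matrix.trace_mul_comm]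
    simp only [← mul_assoc]
    rw [← hT, mul_assoc T c c, hc]
  have h2 : (T * (c * F * E * c)).trace = (T * (c * F * E)).trace := by
    rw [← mul_assoc, Matrix.trace_mul_comm]
    simp only [← mul_assoc]
    rw [← hT, mul_assoc T c c, hc]
  have h3 : (T * (F * c * E * c)).trace = (T * (c * F * c * E)).trace := by
    rw [← mul_assoc, Matrix.trace_mul_comm]
    simp only [← mul_assoc]
    rw [← hT]
  -- Here `E` goes round the trace and must cross `T`; no commutation of `T` with `F` is needed.
  have h4 : (T * (F * c * E)).trace = (c * T * (E * F)).trace := by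
    have e : T * (F * c * E) = (T * F * c) * E := by simp only [mul_assoc]
    rw [e, Matrix.trace_mul_comm]
    have e' : E * (T * F * c) = (E * T) * F * c := by simp only [mul_assoc]
    rw [e', ← hE, Matrix.trace_mul_comm]
    simp only [mul_assoc]
  rw [hX]
  simp only [mul_add, mul_sub, mul_neg, Matrix.trace_add, Matrix.trace_sub, Matrix.trace_neg,
    h1, h2, h3, h4, hT.symm]
  simp only [mul_assoc]
  ring

end matrix

/-! ### Evaluating elements of the coordinate ring, and the pairing as a trace. -/

section evaluation

variable {I : Type*} {D : QuantumCartanDatum I} {N : Type*} [Fintype N] [DecidableEq N]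

/-- The values at `X` of the entries of a matrix over `ℂ_q[G]`. -/
def evalMatrix (X : Uq D) (P : Matrix N N (Cq D)) : Matrix N N ℂ :=
  Matrix.of fun i j => (P i j : UqDual D) X

lemma Cq.counit_act (X : Uq D) (φ : Cq D) : Cq.counit (Cq.act X φ) = (φ : UqDual D) X := by
  change (φ : UqDual D) (1 * X) = _
  rw [one_mul]

lemma UqDual.mul_apply (φ ψ : UqDual D) (X : Uq D) :
    (φ * ψ) X = LinearMap.mul' ℂ ℂ (TensorProduct.map φ.ofConv ψ.ofConv (Uq.comulHom X)) := rfl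

lemma UqDual.mul_one_apply (φ ψ : UqDual D) : (φ * ψ) 1 = φ 1 * ψ 1 := by
  rw [UqDual.mul_apply, map_one, Algebra.TensorProduct.one_def]; simp

lemma UqDual.one_apply_one : (1 : UqDual D) 1 = 1 := by
  change Uq.counitHom (1 : Uq D) = 1
  rw [map_one]

/-- This is `Δ(E_i) = E_i ⊗ K_i + 1 ⊗ E_i` read through the dual product; the next lemma does the
same for `F_i`. -/
lemma UqDual.mul_E_apply (φ ψ : UqDual D) (i : I) :
    (φ * ψ) (Uq.E D i) = φ (Uq.E D i) * ψ (Uq.K D i) + φ 1 * ψ (Uq.E D i) := by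
  rw [UqDual.mul_apply, Uq.comulHom, Uq.lift_E]; simp

lemma UqDual.mul_F_apply (φ ψ : UqDual D) (i : I) :
    (φ * ψ) (Uq.F D i) = φ (Uq.F D i) * ψ 1 + φ (Uq.Kinv D i) * ψ (Uq.F D i) := by
  rw [UqDual.mul_apply, Uq.comulHom, Uq.lift_F]; simp

/-- The counit of `ℂ_q[G]` as an algebra homomorphism. -/
def Cq.counitHom : Cq D →ₐ[ℂ] ℂ :=
  AlgHom.ofLinearMap Cq.counit UqDual.one_apply_one fun φ ψ => UqDual.mul_one_apply φ.1 ψ.1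

lemma evalMatrix_one (P : Matrix N N (Cq D)) :
    evalMatrix 1 P = Cq.counitHom.mapMatrix P := rfl

lemma map_two_smul_sub_one {A : Type*} [Ring A] [Algebra ℂ A] (φ : A →ₐ[ℂ] ℂ) (P : Matrix N N A)
    (j k : N) : φ ((2 • P - 1 : Matrix N N A) j k) =
      (2 * Matrix.of (fun i j => φ (P i j)) - 1 : Matrix N N ℂ) j k := by
  have h : φ ((1 : Matrix N N A) j k) = (1 : Matrix N N ℂ) j k := by
    rw [Matrix.one_apply, Matrix.one_apply, apply_ite φ, map_one, map_zero]
  rw [two_mul, two_smul, Matrix.sub_apply, Matrix.sub_apply, Matrix.add_apply, Matrix.add_apply,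
    map_sub, map_add, h]
  rfl

/-- The functional is a product of one functional per tensor leg, while the chain is a trace whose
matrix indices run through the legs; applying it leg by leg leaves a product of scalar matrices. -/
lemma etaXY_twoChain (X Y : Uq D) (V : Matrix N N ℂ) (P : Matrix N N (Cq D)) :
    etaXY X Y (twoChain V P) =
      (V * ((2 * evalMatrix 1 P - 1) * evalMatrix X P * evalMatrix Y P)).trace := by
  have h : ∀ j k, Cq.counit ((2 • P - 1 : Matrix N N (Cq D)) j k) =
      (2 * evalMatrix 1 P - 1 : Matrix N N ℂ) j k :=
    fun j k => map_two_smul_sub_one Cq.counitHom P j k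
  simp only [twoChain, map_sum, map_smul, etaXY_tmul, h, Cq.counit_act, Matrix.trace,
    Matrix.diag_apply, Matrix.mul_apply (M := V), Matrix.mul_assoc, smul_eq_mul,
    Matrix.mul_apply (M := 2 * evalMatrix 1 P - 1), Finset.mul_sum]
  refine Finset.sum_congr rfl fun i _ => Finset.sum_congr rfl fun j _ =>
    Finset.sum_congr rfl fun k _ => ?_
  rw [Matrix.mul_apply, Finset.mul_sum, Finset.mul_sum]
  refine Finset.sum_congr rfl fun l _ => ?_
  simp only [evalMatrix, Matrix.of_apply]
  ring

end evaluation

/-! ### The pairing of `2ρ` with simple roots, and powers of `q`. -/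

section lie

open LieAlgebra LieAlgebra.IsKilling

variable {𝔤 : Type*} [LieRing 𝔤] [LieAlgebra ℂ 𝔤] [FiniteDimensional ℂ 𝔤] [LieAlgebra.IsSimple ℂ 𝔤]
variable {H : LieSubalgebra ℂ 𝔤} [H.IsCartanSubalgebra]
variable (b : (rootSystem H).Base)

/-- The simple reflection in `α_a` permutes the positive roots other than `α_a` and negates their
pairing with the coroot. Their contributions cancel, leaving `⟨α_a, α_a^∨⟩ = 2`. -/
lemma two_rho_coroot (a : b.support) : ((2 : ℂ) • rho b) ((rootSystem H).coroot a) = 2 := by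
  classical
  have h0 : ((2 : ℂ) • rho b) ((rootSystem H).coroot a) =
      ∑ α ∈ Finset.univ.filter (fun α : H.root => b.IsPos α), (rootSystem H).pairing α a := by
    simp only [rho, smul_smul, LinearMap.smul_apply, LinearMap.sum_apply]
    norm_num
  have ha : (a : H.root) ∈ Finset.univ.filter (fun α : H.root => b.IsPos α) := by
    simpa using RootPairing.Base.isPos_of_mem_support a.2
  rw [h0, ← Finset.add_sum_erase _ _ ha, RootPairing.pairing_same]
  suffices h : ∑ α ∈ (Finset.univ.filter (fun α : H.root => b.IsPos α)).erase a,
      (rootSystem H).pairing α a = 0 by rw [h, add_zero]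
  have hmem : ∀ α ∈ (Finset.univ.filter (fun α : H.root => b.IsPos α)).erase (a : H.root),
      (rootSystem H).reflectionPerm a α ∈
        (Finset.univ.filter (fun α : H.root => b.IsPos α)).erase (a : H.root) := by
    intro α hα
    simp only [Finset.mem_erase, Finset.mem_filter, Finset.mem_univ, true_and] at hα ⊢
    refine ⟨fun h => ?_, hα.2.reflectionPerm a.2 hα.1⟩
    -- If the reflection of `α` were `α_a`, then `α` would be `-α_a`, which is not positive.
    have h' : α = (rootSystem H).reflectionPerm a a := by
      rw [← congrArg ((rootSystem H).reflectionPerm a) h, RootPairing.reflectionPerm_self]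
    have h2 := hα.2
    rw [h'] at h2
    exact (RootPairing.Base.IsPos.neg_iff_not b (a : H.root)).1 h2
      (RootPairing.Base.isPos_of_mem_support a.2)
  -- Reindexing by the reflection shows that the remaining sum equals its own negative.
  refine self_eq_neg.mp ?_
  rw [← Finset.sum_neg_distrib]
  refine Finset.sum_nbij' ((rootSystem H).reflectionPerm a) ((rootSystem H).reflectionPerm a)
    hmem hmem (by simp) (by simp) fun α _ => ?_
  rw [← RootPairing.pairing_reflectionPerm, RootPairing.pairing_reflectionPerm_self_right, neg_neg]

/-- Equivalently `(α_a - 2ρ, α_a) = 0`, which is what makes `K_{α_a - 2ρ}` commute with `E_a`. -/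
lemma form_two_rho (a : b.support) :
    form H ((2 : ℂ) • rho b) (simpleRoot b a) = form H (simpleRoot b a) (simpleRoot b a) := by
  have h := coroot_mul_form H (a : H.root) ((2 : ℂ) • rho b)
  rw [two_rho_coroot] at h
  rw [form_symm]
  exact (mul_left_cancel₀ two_ne_zero h).symm

lemma exists_dSym (i : b.support) : ∃ s : ℝ, s ≠ 0 ∧ dSym b i = s := by
  obtain ⟨s, hs0, hs⟩ := form_root H (i : H.root)
  exact ⟨s / 2, by positivity, by rw [dSym, simpleRoot, hs]; push_cast; rfl⟩

/-- Because `q_i^(x/d_i) = q^x`, the `q_i`-number takes the shape in which the relation for `E_i F_i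
- F_i E_i` produces it. -/
lemma qNumber_dSym {q : ℝ} (hq0 : 0 < q) (i : b.support) (x : ℂ) :
    qNumber ((q : ℂ) ^ dSym b i) ((dSym b i)⁻¹ * x) =
      ((q : ℂ) ^ dSym b i - ((q : ℂ) ^ dSym b i)⁻¹)⁻¹ *
        ((q : ℂ) ^ x - ((q : ℂ) ^ x)⁻¹) := by
  obtain ⟨s, hs0, hs⟩ := exists_dSym b i
  have h : ∀ y : ℂ, ((q : ℂ) ^ dSym b i) ^ ((dSym b i)⁻¹ * y) = (q : ℂ) ^ y := by
    intro y
    -- Complex powers multiply only when the logarithm stays on the principal branch; it does, since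
    -- `log q` and `d_i` are real.
    have him : (Complex.log q * dSym b i).im = 0 := by
      rw [hs, ← Complex.ofReal_log hq0.le, ← Complex.ofReal_mul, Complex.ofReal_im]
    rw [← Complex.cpow_mul _ (by rw [him]; linarith [Real.pi_pos])
      (by rw [him]; exact Real.pi_pos.le), ← mul_assoc, mul_inv_cancel₀, one_mul]
    rw [hs]; exact_mod_cast hs0
  rw [qNumber, ← mul_neg, h, h, Complex.cpow_neg, div_eq_inv_mul]

lemma coe_eq_sum_simpleRoot (lam : (rootSystem H).rootSpan ℤ) :
    (lam : Module.Dual ℂ H) = ∑ i, (b.toWeightBasisInt.repr lam i) • simpleRoot b i := by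
  conv_lhs => rw [← b.toWeightBasisInt.sum_repr lam]
  simp [simpleRoot]

/-- `q ^ (λ, μ)` is determined by the values `q ^ (α_i, μ)`. -/
lemma cpow_form_eq_prod {q : ℝ} (hq0 : 0 < q) (lam : (rootSystem H).rootSpan ℤ)
    (μ : Module.Dual ℂ H) :
    (q : ℂ) ^ form H lam μ =
      ∏ i, ((q : ℂ) ^ form H (simpleRoot b i) μ) ^ b.toWeightBasisInt.repr lam i := by
  have hq : (q : ℂ) ≠ 0 := by exact_mod_cast hq0.ne'
  rw [coe_eq_sum_simpleRoot b lam]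
  simp only [map_sum, LinearMap.sum_apply, Complex.cpow_def_of_ne_zero hq, Finset.mul_sum,
    Complex.exp_sum, ← Complex.exp_int_mul, map_zsmul, LinearMap.smul_apply, zsmul_eq_mul]
  exact Finset.prod_congr rfl fun i _ => by ring_nf

/-! ### The values of `P` at `1`, `E_a` and `F_a`. -/

namespace WeightBasis

variable {b} {q : ℝ} {hq0 : 0 < q} {hq1 : q ≠ 1}
variable {V : Type*} [NormedAddCommGroup V] [InnerProductSpace ℂ V]
variable {π : Uq (datum b q hq0 hq1) →ₐ[ℂ] Module.End ℂ V} {N : ℕ} (B : WeightBasis π N)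

lemma mat_apply (X : Uq (datum b q hq0 hq1)) (i j : Fin N) :
    B.mat X i j = inner ℂ (B.vec i) (π X (B.vec j)) := by
  change LinearMap.toMatrixAlgEquiv B.vec.toBasis (π X) i j = _
  rw [LinearMap.toMatrixAlgEquiv_apply, OrthonormalBasis.coe_toBasis,
    OrthonormalBasis.coe_toBasis_repr_apply, OrthonormalBasis.repr_apply_apply]

lemma mat_star (hunit : IsUnitaryRep π) (X : Uq (datum b q hq0 hq1)) :
    B.mat (star X) = (B.mat X).conjTranspose := by
  ext i j
  rw [Matrix.conjTranspose_apply, mat_apply, mat_apply, ← hunit]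
  exact (inner_conj_symm _ _).symm

/-- The conjugation in `φ^*` and the conjugate transpose coming from the invariant inner product
cancel, so only the antipode and a swap of indices remain. -/
lemma star_u_apply (hunit : IsUnitaryRep π) (m i : Fin N) (X : Uq (datum b q hq0 hq1)) :
    (star (B.u m i) : Cq (datum b q hq0 hq1)).1 X = B.mat (Uq.antipode X) i m := by
  change starRingEnd ℂ (B.mat (star (Uq.antipode X)) m i) = _
  rw [B.mat_star hunit, Matrix.conjTranspose_apply]
  exact star_star _

lemma evalMatrix_projP (c : Matrix (Fin N) (Fin N) ℂ) (X : Uq (datum b q hq0 hq1)) (i j : Fin N) :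
    evalMatrix X (B.projP c) i j =
      ∑ m, ∑ n, c m n * ((star (B.u m i)).1 * (B.u n j).1 : UqDual (datum b q hq0 hq1)) X := by
  -- Evaluation at `X` is packaged as a linear map so that it passes through the sums defining `P`.
  let ev : Cq (datum b q hq0 hq1) →ₗ[ℂ] ℂ := Cq.counit ∘ₗ Cq.act X
  have hev : ∀ φ : Cq (datum b q hq0 hq1), ev φ = φ.1 X := fun φ => Cq.counit_act X φ
  have h : evalMatrix X (B.projP c) i j = ev (B.projP c i j) := (hev _).symm
  rw [h, projP]
  simp only [Matrix.sum_apply, Matrix.smul_apply, map_sum, map_smul, smul_eq_mul, matrixUnit,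
    Matrix.of_apply]
  simp only [hev]
  rfl

/-- Each coproduct term `X₁ ⊗ X₂` contributes such a double sum to the value of `P`, with `A =
π(S(X₁))` and `C = π(X₂)`. -/
lemma sum_mul_mul (A c C : Matrix (Fin N) (Fin N) ℂ) (i j : Fin N) :
    ∑ m, ∑ n, c m n * (A i m * C n j) = (A * c * C) i j := by
  rw [Matrix.mul_assoc, Matrix.mul_apply]
  simp only [Matrix.mul_apply, Finset.mul_sum]
  exact Finset.sum_congr rfl fun _ _ => Finset.sum_congr rfl fun _ _ => by ring

lemma u_apply (i j : Fin N) (X : Uq (datum b q hq0 hq1)) : (B.u i j).1 X = B.mat X i j := rfl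

lemma evalMatrix_projP_one (hunit : IsUnitaryRep π) (c : Matrix (Fin N) (Fin N) ℂ) :
    evalMatrix 1 (B.projP c) = c := by
  ext i j
  rw [evalMatrix_projP]
  simp only [UqDual.mul_one_apply, star_u_apply B hunit, u_apply, sum_mul_mul, Uq.antipode_one,
    map_one, one_mul, mul_one]

/-- The two terms come from `1 ⊗ E_a` and from `E_a ⊗ K_a` with `S(E_a) = -E_a K_a⁻¹`. -/
lemma evalMatrix_projP_E (hunit : IsUnitaryRep π) (c : Matrix (Fin N) (Fin N) ℂ) (a : b.support) :
    evalMatrix (Uq.E _ a) (B.projP c) =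
      c * B.mat (Uq.E _ a) - B.mat (Uq.E _ a) * B.mat (Uq.Kinv _ a) * c * B.mat (Uq.K _ a) := by
  ext i j
  rw [evalMatrix_projP]
  simp only [UqDual.mul_E_apply, star_u_apply B hunit, u_apply, mul_add, Finset.sum_add_distrib,
    sum_mul_mul, Uq.antipode_one, Uq.antipode_E, map_one, map_neg, map_mul, one_mul]
  simp only [Matrix.sub_apply, neg_mul, Matrix.neg_apply]
  ring

/-- The two terms come from `K_a⁻¹ ⊗ F_a` with `S(K_a⁻¹) = K_a` and from `F_a ⊗ 1` with `S(F_a) =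
-K_a F_a`. -/
lemma evalMatrix_projP_F (hunit : IsUnitaryRep π) (c : Matrix (Fin N) (Fin N) ℂ) (a : b.support) :
    evalMatrix (Uq.F _ a) (B.projP c) =
      B.mat (Uq.K _ a) * c * B.mat (Uq.F _ a) - B.mat (Uq.K _ a) * B.mat (Uq.F _ a) * c := by
  ext i j
  rw [evalMatrix_projP]
  simp only [UqDual.mul_F_apply, star_u_apply B hunit, u_apply, mul_add, Finset.sum_add_distrib,
    sum_mul_mul, Uq.antipode_Kinv, Uq.antipode_F, map_one, map_neg, map_mul, mul_one]
  simp only [Matrix.sub_apply, neg_mul, Matrix.neg_apply]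
  ring

/-! ### Diagonal action of the torus elements and what commutes with it. -/

/-- The scalar by which `K_λ` acts on the `j`-th basis vector. -/
def char (lam : Module.Dual ℂ H) (j : Fin N) : ℂ := (q : ℂ) ^ form H lam (B.wt j)

lemma char_ne_zero (lam : Module.Dual ℂ H) (j : Fin N) : B.char lam j ≠ 0 := by
  have hq : (q : ℂ) ≠ 0 := by exact_mod_cast hq0.ne'
  rw [char, Complex.cpow_def_of_ne_zero hq]
  exact Complex.exp_ne_zero _

lemma char_sub (lam μ : Module.Dual ℂ H) (j : Fin N) :
    B.char (lam - μ) j = B.char lam j * (B.char μ j)⁻¹ := by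
  have hq : (q : ℂ) ≠ 0 := by exact_mod_cast hq0.ne'
  rw [char, map_sub, LinearMap.sub_apply, Complex.cpow_sub _ _ hq, div_eq_mul_inv]
  rfl

lemma mat_K_eq (i : b.support) :
    B.mat (Uq.K _ i) = Matrix.diagonal (B.char (simpleRoot b i)) := by
  ext k j
  have h := congrFun (B.mat_K i j) k
  rw [Matrix.mulVec_single_one, Matrix.col_apply] at h
  rw [h, Matrix.diagonal_apply, char]
  rcases eq_or_ne k j with rfl | hkj <;> simp [*]

/-- The invertible diagonal matrix through which `K_i` acts. -/
def charUnit (i : b.support) : (Fin N → ℂ)ˣ where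
  val := B.char (simpleRoot b i)
  inv := (B.char (simpleRoot b i))⁻¹
  val_inv := by ext j; simp [B.char_ne_zero]
  inv_val := by ext j; simp [B.char_ne_zero]

/-- Stated in unit groups so that inverses and integer powers of `K_i` are transported without
further computation. -/
lemma mat_Kunit (i : b.support) :
    Units.map (B.mat : _ →* _) (Uq.Kunit (datum b q hq0 hq1) i) =
      Units.map (Matrix.diagonalRingHom (Fin N) ℂ).toMonoidHom (B.charUnit i) :=
  Units.ext (B.mat_K_eq i)

lemma mat_Kinv_eq (i : b.support) :
    B.mat (Uq.Kinv _ i) = Matrix.diagonal (B.char (simpleRoot b i))⁻¹ :=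
  congrArg (fun u : (Matrix (Fin N) (Fin N) ℂ)ˣ => (u⁻¹).1) (B.mat_Kunit i)

lemma mat_Klam (lam : (rootSystem H).rootSpan ℤ) :
    Units.map (B.mat : _ →* _) (Klam b q hq0 hq1 lam) =
      Units.map (Matrix.diagonalRingHom (Fin N) ℂ).toMonoidHom
        (∏ i, B.charUnit i ^ b.toWeightBasisInt.repr lam i) := by
  -- `K_λ` is a product of commuting units in a noncommutative ring; writing the diagonal side in
  -- the same form lets the two images be compared factor by factor.
  rw [← Finset.noncommProd_eq_prod]
  refine (Finset.map_noncommProd _ _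
    (fun i _ j _ _ => Commute.zpow_zpow (Units.ext ((Uq.realization _).K_K i j)) _ _)
    (Units.map (B.mat : Uq (datum b q hq0 hq1) →* Matrix (Fin N) (Fin N) ℂ))).trans
    (Eq.trans ?_ (Finset.map_noncommProd _ _ _
      (Units.map (Matrix.diagonalRingHom (Fin N) ℂ).toMonoidHom)).symm)
  refine Finset.noncommProd_congr rfl (fun i _ => ?_) _
  rw [map_zpow, map_zpow, mat_Kunit]

lemma coe_prod_charUnit (lam : (rootSystem H).rootSpan ℤ) :
    ((∏ i, B.charUnit i ^ b.toWeightBasisInt.repr lam i : (Fin N → ℂ)ˣ) : Fin N → ℂ) =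
      B.char lam := by
  ext j
  rw [char, cpow_form_eq_prod b hq0]
  have := congrArg Units.val (map_prod (Units.map (Pi.evalMonoidHom (fun _ : Fin N => ℂ) j))
    (fun i => B.charUnit i ^ b.toWeightBasisInt.repr lam i) Finset.univ)
  simp only [map_zpow, Units.coe_prod, Units.val_zpow_eq_zpow_val] at this
  exact this

lemma mat_Klam_inv (lam : (rootSystem H).rootSpan ℤ) :
    B.mat ↑(Klam b q hq0 hq1 lam)⁻¹ = Matrix.diagonal (B.char lam)⁻¹ := by
  have h : B.mat ↑(Klam b q hq0 hq1 lam)⁻¹ = Matrix.diagonal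
      (((∏ i, B.charUnit i ^ b.toWeightBasisInt.repr lam i)⁻¹ : (Fin N → ℂ)ˣ) : Fin N → ℂ) := by
    have := congrArg (fun u : (Matrix (Fin N) (Fin N) ℂ)ˣ => (u⁻¹).1) (B.mat_Klam lam)
    simp only [← map_inv] at this
    exact this
  rw [h, ← B.coe_prod_charUnit]
  congr 1
  exact eq_inv_of_mul_eq_one_left (Units.inv_mul _)

/-- Comparing entries in `K_i E_a = q^(α_i, α_a) E_a K_i` shows that `E_a` multiplies the
`K_i`-eigenvalue by `q^(α_i, α_a)`. Eigenvalues are used in place of weights because they are what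
the relation controls directly. -/
lemma mat_E_apply_eq_zero (a i : b.support) (k j : Fin N)
    (h : B.char (simpleRoot b i) k ≠
      (q : ℂ) ^ form H (simpleRoot b i) (simpleRoot b a) * B.char (simpleRoot b i) j) :
    B.mat (Uq.E _ a) k j = 0 := by
  have hK := congrArg B.mat ((Uq.realization (datum b q hq0 hq1)).K_E i a)
  have hq : (datum b q hq0 hq1).qi i ^ (datum b q hq0 hq1).a i a =
      (q : ℂ) ^ form H (simpleRoot b i) (simpleRoot b a) := by
    change ((q : ℂ) ^ dSym b i) ^ cartanInt b i a = _
    rw [← Complex.cpow_mul_int, ← form_simpleRoot]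
  rw [hq, map_mul, map_smul, map_mul, mat_K_eq] at hK
  have := congrFun (congrFun hK k) j
  rw [Matrix.diagonal_mul, Matrix.smul_apply, Matrix.mul_diagonal, smul_eq_mul] at this
  by_contra h0
  exact h (mul_right_cancel₀ h0 (by rw [this]; ring))

/-- `E_a` commutes with `K_λ` if `(λ, α_a) = 0`. -/
lemma diagonal_char_mul_mat_E (a : b.support) (lam : (rootSystem H).rootSpan ℤ)
    (hlam : form H lam (simpleRoot b a) = 0) :
    Matrix.diagonal (B.char lam) * B.mat (Uq.E _ a) =
      B.mat (Uq.E _ a) * Matrix.diagonal (B.char lam) := by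
  ext k j
  rw [Matrix.diagonal_mul, Matrix.mul_diagonal, mul_comm]
  by_cases h : ∀ i, B.char (simpleRoot b i) k =
      (q : ℂ) ^ form H (simpleRoot b i) (simpleRoot b a) * B.char (simpleRoot b i) j
  -- The eigenvalue of `K_λ` is a product of integer powers of those of the `K_i`, so on this entry
  -- it changes by the factor `q^(λ, α_a) = 1`.
  · congr 1
    rw [char, cpow_form_eq_prod b hq0]
    simp only [char] at h
    simp only [h, mul_zpow, Finset.prod_mul_distrib, ← cpow_form_eq_prod b hq0, hlam,
      Complex.cpow_zero, one_mul, char]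
  · push Not at h
    obtain ⟨i, hi⟩ := h
    rw [B.mat_E_apply_eq_zero a i k j hi, zero_mul, zero_mul]

/-- A nonzero entry of `c` joins basis vectors of equal weight, on which the diagonal matrix has
equal entries. -/
lemma diagonal_char_comm {c : Matrix (Fin N) (Fin N) ℂ}
    (hc : ∀ m n, B.wt m ≠ B.wt n → c m n = 0) (lam : Module.Dual ℂ H) :
    Matrix.diagonal (B.char lam) * c = c * Matrix.diagonal (B.char lam) := by
  ext m n
  rw [Matrix.diagonal_mul, Matrix.mul_diagonal, mul_comm]
  by_cases h : B.wt m = B.wt n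
  · rw [char, char, h]
  · rw [hc m n h, zero_mul, zero_mul]

/-- Apply the counit, an algebra homomorphism, to the entries of `P² = P`; it sends `P` to `c`. -/
lemma mul_self_of_isIdempotentElem (hunit : IsUnitaryRep π) {c : Matrix (Fin N) (Fin N) ℂ}
    (hP : IsIdempotentElem (B.projP c)) : c * c = c := by
  have h := congrArg Cq.counitHom.mapMatrix hP.eq
  rwa [map_mul, ← evalMatrix_one, B.evalMatrix_projP_one hunit] at h

lemma diagonal_char_inv_mul (lam : Module.Dual ℂ H) :
    Matrix.diagonal (B.char lam)⁻¹ * Matrix.diagonal (B.char lam) = 1 := by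
  rw [Matrix.diagonal_mul_diagonal, ← Matrix.diagonal_one]
  congr 1
  ext j
  exact inv_mul_cancel₀ (B.char_ne_zero _ _)

lemma diagonal_char_inv_mul_char (lam μ : Module.Dual ℂ H) :
    Matrix.diagonal (B.char μ)⁻¹ * Matrix.diagonal (B.char lam) =
      Matrix.diagonal (B.char (lam - μ)) := by
  rw [Matrix.diagonal_mul_diagonal]
  congr 1
  ext j
  rw [B.char_sub, mul_comm]
  rfl

lemma evalMatrix_projP_E_of_weight (hunit : IsUnitaryRep π) {c : Matrix (Fin N) (Fin N) ℂ}
    (hc : ∀ m n, B.wt m ≠ B.wt n → c m n = 0) (a : b.support) :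
    evalMatrix (Uq.E _ a) (B.projP c) = c * B.mat (Uq.E _ a) - B.mat (Uq.E _ a) * c := by
  rw [B.evalMatrix_projP_E hunit, B.mat_Kinv_eq, B.mat_K_eq, Matrix.mul_assoc _ c,
    ← B.diagonal_char_comm hc, ← Matrix.mul_assoc, Matrix.mul_assoc (B.mat _),
    B.diagonal_char_inv_mul, Matrix.mul_one]

/-- The diagonal factor in front is what later shifts the twist from `-2ρ` to `α_a - 2ρ`. -/
lemma evalMatrix_projP_F_of_weight (hunit : IsUnitaryRep π) (c : Matrix (Fin N) (Fin N) ℂ)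
    (a : b.support) :
    evalMatrix (Uq.F _ a) (B.projP c) = Matrix.diagonal (B.char (simpleRoot b a)) *
      (c * B.mat (Uq.F _ a) - B.mat (Uq.F _ a) * c) := by
  rw [B.evalMatrix_projP_F hunit, B.mat_K_eq, Matrix.mul_sub, Matrix.mul_assoc, Matrix.mul_assoc]

lemma mat_E_mul_mat_F_sub (a : b.support) :
    B.mat (Uq.E _ a) * B.mat (Uq.F _ a) - B.mat (Uq.F _ a) * B.mat (Uq.E _ a) =
      ((q : ℂ) ^ dSym b a - ((q : ℂ) ^ dSym b a)⁻¹)⁻¹ •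
        (Matrix.diagonal (B.char (simpleRoot b a)) -
          Matrix.diagonal (B.char (simpleRoot b a))⁻¹) := by
  have h := congrArg B.mat ((Uq.realization (datum b q hq0 hq1)).E_F_same a)
  rw [map_sub, map_mul, map_mul, map_smul, map_sub, B.mat_K_eq, B.mat_Kinv_eq] at h
  exact h

/-! ### Assembling the pairing. -/

/-- The element `α_a - 2ρ` of the root lattice. -/
def rootSubTwoRho (a : b.support) : (rootSystem H).rootSpan ℤ :=
  (rootSystem H).rootSpanMem ℤ a - twoRho b

lemma coe_rootSubTwoRho (a : b.support) :
    (rootSubTwoRho a : Module.Dual ℂ H) = simpleRoot b a - (2 : ℂ) • rho b := by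
  rw [rootSubTwoRho, Submodule.coe_sub, coe_twoRho]
  rfl

lemma eta_cycle (hunit : IsUnitaryRep π) {c : Matrix (Fin N) (Fin N) ℂ}
    (hP : IsIdempotentElem (B.projP c)) (hc : ∀ m n, B.wt m ≠ B.wt n → c m n = 0)
    (a : b.support) :
    eta a (B.cycle (B.projP c)) =
      (c * Matrix.diagonal (B.char (simpleRoot b a - (2 : ℂ) • rho b)) *
        (B.mat (Uq.E _ a) * B.mat (Uq.F _ a) - B.mat (Uq.F _ a) * B.mat (Uq.E _ a))).trace := by
  have hTE := B.diagonal_char_mul_mat_E a (rootSubTwoRho a) (by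
    rw [coe_rootSubTwoRho, map_sub, LinearMap.sub_apply, form_two_rho, sub_self])
  rw [coe_rootSubTwoRho] at hTE
  have hK := B.diagonal_char_comm hc (simpleRoot b a)
  -- This brings the `K_a` contained in the value of `P` at `F_a` to the left, next to `K_{2ρ}⁻¹`.
  have hcK : (2 * c - 1) * Matrix.diagonal (B.char (simpleRoot b a)) =
      Matrix.diagonal (B.char (simpleRoot b a)) * (2 * c - 1) := by
    rw [sub_mul, mul_sub, one_mul, mul_one, two_mul, add_mul, mul_add, hK]
  refine (etaXY_twoChain _ _ _ _).trans ?_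
  -- The trace identity is used from right to left, with `T = K_{2ρ}⁻¹ K_a` split back into its two
  -- factors to match the chain.
  rw [← trace_twoChain_eq (B.mul_self_of_isIdempotentElem hunit hP)
    (B.diagonal_char_comm hc _) hTE, B.mat_Klam_inv, coe_twoRho, ← B.diagonal_char_inv_mul_char]
  rw [B.evalMatrix_projP_one hunit, B.evalMatrix_projP_E_of_weight hunit hc,
    B.evalMatrix_projP_F_of_weight hunit, ← Matrix.mul_assoc (2 * c - 1), hcK]
  simp only [Matrix.mul_assoc]

end WeightBasis

end lie

end QuantumFlag

end

open QuantumFlag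
theorem mainTheorem4 {𝔤 : Type*} [LieRing 𝔤] [LieAlgebra ℂ 𝔤] [FiniteDimensional ℂ 𝔤]
    [LieAlgebra.IsSimple ℂ 𝔤] (H : LieSubalgebra ℂ 𝔤) [H.IsCartanSubalgebra]
    (b : (LieAlgebra.IsKilling.rootSystem H).Base) (q : ℝ) (hq0 : 0 < q) (hq1 : q ≠ 1)
    {V : Type*} [NormedAddCommGroup V] [InnerProductSpace ℂ V] [FiniteDimensional ℂ V]
    (π : Uq (datum b q hq0 hq1) →ₐ[ℂ] Module.End ℂ V) (Lam : Module.Dual ℂ H)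
    (hirr : IsIrrepOfHighestWeight π Lam) (hunit : IsUnitaryRep π)
    {N : ℕ} (B : WeightBasis π N) (c : Matrix (Fin N) (Fin N) ℂ)
    (hP : IsIdempotentElem (B.projP c))
    (hc : ∀ m n, B.wt m ≠ B.wt n → c m n = 0) (a : b.support) :
    eta a (B.cycle (B.projP c)) =
      ∑ i, c i i * (q : ℂ) ^ form H (simpleRoot b a - (2 : ℂ) • rho b) (B.wt i) *
        qNumber ((q : ℂ) ^ dSym b a) ((dSym b a)⁻¹ * form H (simpleRoot b a) (B.wt i)) := by
  rw [B.eta_cycle hunit hP hc, B.mat_E_mul_mat_F_sub, Matrix.trace]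
  refine Finset.sum_congr rfl fun i _ => ?_
  -- Both factors to the right of `c` are diagonal, so the `i`-th diagonal entry involves only `c i
  -- i`.
  rw [qNumber_dSym b hq0, Matrix.diag_apply, Matrix.mul_smul, Matrix.diagonal_sub,
    Matrix.smul_apply, Matrix.mul_diagonal, Matrix.mul_diagonal, smul_eq_mul, mul_left_comm]
  rfl
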